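/- Let $K$ be a field. Let $\mathcal P_\nearrow$ be the symmetric operad of $K$-vector spaces generated by two binary operations without symmetry $m,\nearrow$ (a basis of a free $S_2$-module $E$) with the relations $$\nearrow\circ(\nearrow,I)=\nearrow\circ(I,\nearrow),\qquad \nearrow\circ(I,m)=m\circ(\nearrow,I),\qquad m\circ(m,I)=m\circ(I,m).$$ Let $R\subseteq F(E)(3)$ be the $S_3$-submodule of relations, where $F(E)$ is the free operad on $E$. Let $\mathcal P_\nearrow^!=F(E^\vee)/(R^\perp)$, with $E^\vee=E^*\otimes\mathrm{sgn}$, be the Koszul dual operad, whose generators dual to $m,\nearrow$ are again denoted by $m,\nearrow$. Here $R^\perp$ is the orthogonal of $R$ for the pairing of $F(E^\vee)(3)$ with $F(E)(3)$ in which $(a\circ(b,I))\sigma$ pairs with itself to $\mathrm{sgn}(\sigma)$, $(a\circ(I,b))\sigma$ pairs with itself to $-\mathrm{sgn}(\sigma)$ for $a,b\in\{m,\nearrow\}$, $\sigma\in S_3$, and distinct tree monomials are orthogonal. 1. For all $n\ge 1$, $\dim_K\mathcal P_\nearrow^!(n)=n\cdot n!$. 2. For all $n\ge1$, $\mathcal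 P_\nearrow^!(n)$ is a free $K[S_n]$-module with basis the classes of the $n$ right combs $$x_1\nearrow(x_2\nearrow(\cdots(x_{i-1}\nearrow(x_i\cdot(x_{i+1}\cdot(\cdots(x_{n-1}\cdot x_n)\cdots))))\cdots)),\qquad 1\le i\le n,$$ with $i-1$ vertices $\nearrow$ followed by $n-i$ vertices $m$ (written $\cdot$). 3. For a $K$-vector space $V$ let $T_\nearrow(V)=\bigoplus_{n\ge1}\bigoplus_{k=1}^n V^{\otimes n}$. In the $k$-th copy of $V^{\otimes n}$, the first $k-1$ of the $n-1$ tensor signs are marked. For $v=v_1\otimes\cdots\otimes v_p$ in the $k$-th copy of $V^{\otimes p}$ and $w=w_1\otimes\cdots\otimes w_q$ in the $l$-th copy of $V^{\otimes q}$, put: - $m(v,w)=0$ if $l\ne1$; if $l=1$, $m(v,w)=v_1\otimes\cdots\otimes v_p\otimes w_1\otimes\cdots\otimes w_q$ in the $k$-th copy of $V^{\otimes(p+q)}$; - $v\nearrow w=0$ if $k\neq p$; if $k=p$, $v\nearrow w=v_1\otimes\cdots\otimes v_p\otimes w_1\otimes\cdots\otimes w_q$ in the $(p+l)$-th copy of $V^{\otimes(p+q)}$.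 These products make $T_\nearrow(V)$ a $\mathcal P_\nearrow^!$-algebra, and it is the free $\mathcal P_\nearrow^!$-algebra on $V$: for every $\mathcal P_\nearrow^!$-algebra $A$ and every linear map $g:V\to A$ there is a unique morphism of $\mathcal P_\nearrow^!$-algebras $f:T_\nearrow(V)\to A$ whose restriction to $V=V^{\otimes1}$ is $g$. -/

import Mathlib

universe u v w

/-! ### Symmetric operads

Operads are written in their coordinate-free form: an operad has a space of operations whose inputs
are labelled by a finite set `L`; bijections relabel inputs, and partial composition plugs an
operation into one input. The component of arity `n` is the one of `Fin n`. -/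

namespace OperadAux

/-- `A ⊔ (B ⊔ {*}) ≃ (A ⊔ B) ⊔ {*}`. -/
def sumOption (A B : Type) : A ⊕ Option B ≃ Option (A ⊕ B) where
  toFun s := match s with
    | .inl a => some (.inl a)
    | .inr none => none
    | .inr (some b) => some (.inr b)
  invFun o := match o with
    | none => .inr none
    | some (.inl a) => .inl a
    | some (.inr b) => .inr (some b)
  left_inv := by rintro (a | (_ | b)) <;> rfl
  right_inv := by rintro (_ | (a | b)) <;> rfl

/-- `(A ⊔ {*}) ⊔ B ≃ (A ⊔ B) ⊔ {*}`. -/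
def optionSum (A B : Type) : Option A ⊕ B ≃ Option (A ⊕ B) where
  toFun s := match s with
    | .inl none => none
    | .inl (some a) => some (.inl a)
    | .inr b => some (.inr b)
  invFun o := match o with
    | none => .inl none
    | some (.inl a) => .inl (some a)
    | some (.inr b) => .inr b
  left_inv := by rintro ((_ | a) | b) <;> rfl
  right_inv := by rintro (_ | (a | b)) <;> rfl

/-- Exchange of the two added points of `(A ⊔ {*}) ⊔ {*'}`. -/
def optionSwap (A : Type) : Option (Option A) ≃ Option (Option A) where
  toFun o := match o with
    | none => some none
    | some none => none
    | some (some a) => some (some a)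
  invFun o := match o with
    | none => some none
    | some none => none
    | some (some a) => some (some a)
  left_inv := by rintro (_ | (_ | a)) <;> rfl
  right_inv := by rintro (_ | (_ | a)) <;> rfl

/-- `(A ⊔ C) ⊔ B ≃ (A ⊔ B) ⊔ C`. -/
def sumSwapRight (A B C : Type) : (A ⊕ C) ⊕ B ≃ (A ⊕ B) ⊕ C where
  toFun s := match s with
    | .inl (.inl a) => .inl (.inl a)
    | .inl (.inr c) => .inr c
    | .inr b => .inl (.inr b)
  invFun s := match s with
    | .inl (.inl a) => .inl (.inl a)
    | .inl (.inr b) => .inr b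
    | .inr c => .inl (.inr c)
  left_inv := by rintro ((a | c) | b) <;> rfl
  right_inv := by rintro ((a | b) | c) <;> rfl

/-- A one-point set is `∅ ⊔ {*}`. -/
def unitOption : Unit ≃ Option Empty where
  toFun _ := none
  invFun _ := ()
  left_inv _ := rfl
  right_inv o := by rcases o with _ | a <;> [rfl; exact a.elim]

end OperadAux

open OperadAux in
/-- A symmetric operad in `K`-vector spaces. For an operation `x` with inputs `A ⊔ {*}` and an
operation `y` with inputs `B`, `comp x y` is the partial composition `x ∘_* y`, with inputs
`A ⊔ B`. -/
structure SymOperad (K : Type u) [Field K] where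
  /-- operations with inputs labelled by `L` -/
  obj : Type → Type v
  [addCommGroup : ∀ L, AddCommGroup (obj L)]
  [module : ∀ L, Module K (obj L)]
  /-- relabelling of the inputs -/
  map : ∀ {L L' : Type} [Finite L] [Finite L'], (L ≃ L') → obj L →ₗ[K] obj L'
  /-- the identity operation -/
  unit : obj Unit
  /-- partial composition -/
  comp : ∀ {A B : Type} [Finite A] [Finite B],
    obj (Option A) →ₗ[K] obj B →ₗ[K] obj (A ⊕ B)
  map_refl : ∀ {L : Type} [Finite L] (x : obj L), map (Equiv.refl L) x = x
  map_trans : ∀ {L L' L'' : Type} [Finite L] [Finite L'] [Finite L''] (e : L ≃ L') (f : L' ≃ L'')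
    (x : obj L), map (e.trans f) x = map f (map e x)
  comp_map : ∀ {A A' B B' : Type} [Finite A] [Finite A'] [Finite B] [Finite B']
    (e : A ≃ A') (f : B ≃ B') (x : obj (Option A)) (y : obj B),
    comp (map (Equiv.optionCongr e) x) (map f y) = map (Equiv.sumCongr e f) (comp x y)
  /-- sequential associativity `(x ∘ y) ∘ z = x ∘ (y ∘ z)` -/
  comp_seq : ∀ {A B C : Type} [Finite A] [Finite B] [Finite C]
    (x : obj (Option A)) (y : obj (Option B)) (z : obj C),
    comp (map (sumOption A B) (comp x y)) z =
      map (Equiv.sumAssoc A B C).symm (comp x (comp y z))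
  /-- parallel associativity: compositions at two distinct inputs commute -/
  comp_par : ∀ {A B C : Type} [Finite A] [Finite B] [Finite C]
    (x : obj (Option (Option A))) (y : obj B) (z : obj C),
    comp (map (optionSum A B) (comp x y)) z =
      map (sumSwapRight A B C) (comp (map (optionSum A C) (comp (map (optionSwap A) x) z)) y)
  unit_comp : ∀ {B : Type} [Finite B] (y : obj B),
    comp (map unitOption unit) y = map (Equiv.emptySum Empty B).symm y
  comp_unit : ∀ {A : Type} [Finite A] (x : obj (Option A)),
    comp x unit = map (Equiv.optionEquivSumPUnit A) x

namespace SymOperad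

attribute [instance] SymOperad.addCommGroup SymOperad.module

variable {K : Type u} [Field K]

/-- The `S_L`-module structure of the space of operations with inputs `L`. -/
def rep (O : SymOperad.{u, v} K) (L : Type) [Finite L] :
    Representation K (Equiv.Perm L) (O.obj L) where
  toFun σ := O.map σ
  map_one' := LinearMap.ext fun x => O.map_refl x
  map_mul' σ τ := LinearMap.ext fun x => O.map_trans τ σ x

/-- An operadic ideal: a family of subspaces stable under relabelling and under partial composition
on either side with arbitrary operations. -/
structure IsIdeal (O : SymOperad.{u, v} K) (I : ∀ L : Type, Submodule K (O.obj L)) : Prop where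
  map_mem : ∀ {L L' : Type} [Finite L] [Finite L'] (e : L ≃ L') (x : O.obj L),
    x ∈ I L → O.map e x ∈ I L'
  comp_mem_left : ∀ {A B : Type} [Finite A] [Finite B] (x : O.obj (Option A)) (y : O.obj B),
    x ∈ I (Option A) → O.comp x y ∈ I (A ⊕ B)
  comp_mem_right : ∀ {A B : Type} [Finite A] [Finite B] (x : O.obj (Option A)) (y : O.obj B),
    y ∈ I B → O.comp x y ∈ I (A ⊕ B)

/-- The operadic ideal generated by a set of operations of arity `3`: the intersection of all
ideals that contain it. -/
def idealSpan (O : SymOperad.{u, v} K) (R : Set (O.obj (Fin 3))) (L : Type) :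
    Submodule K (O.obj L) :=
  sInf {S | ∃ J : ∀ L : Type, Submodule K (O.obj L), O.IsIdeal J ∧ R ⊆ J (Fin 3) ∧ S = J L}

theorem mem_idealSpan (O : SymOperad.{u, v} K) (R : Set (O.obj (Fin 3))) {L : Type}
    {x : O.obj L} : x ∈ O.idealSpan R L ↔
      ∀ J : ∀ L : Type, Submodule K (O.obj L), O.IsIdeal J → R ⊆ J (Fin 3) → x ∈ J L := by
  simp only [idealSpan, Submodule.mem_sInf, Set.mem_ofPred_eq]
  constructor
  · intro h J hJ hR
    exact h _ ⟨J, hJ, hR, rfl⟩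
  · rintro h _ ⟨J, hJ, hR, rfl⟩
    exact h J hJ hR

theorem isIdeal_idealSpan (O : SymOperad.{u, v} K) (R : Set (O.obj (Fin 3))) :
    O.IsIdeal (O.idealSpan R) where
  map_mem e x hx := (mem_idealSpan O R).2 fun J hJ hR =>
    hJ.map_mem e x ((mem_idealSpan O R).1 hx J hJ hR)
  comp_mem_left x y hx := (mem_idealSpan O R).2 fun J hJ hR =>
    hJ.comp_mem_left x y ((mem_idealSpan O R).1 hx J hJ hR)
  comp_mem_right x y hy := (mem_idealSpan O R).2 fun J hJ hR =>
    hJ.comp_mem_right x y ((mem_idealSpan O R).1 hy J hJ hR)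

/-- Relabelling of the inputs in the quotient by an ideal. -/
def quotMap (O : SymOperad.{u, v} K) {I : ∀ L : Type, Submodule K (O.obj L)} (hI : O.IsIdeal I)
    {L L' : Type} [Finite L] [Finite L'] (e : L ≃ L') : (O.obj L ⧸ I L) →ₗ[K] (O.obj L' ⧸ I L') :=
  (I L).mapQ (I L') (O.map e) fun x hx => hI.map_mem e x hx

/-- Partial composition in the quotient by an ideal. -/
def quotComp (O : SymOperad.{u, v} K) {I : ∀ L : Type, Submodule K (O.obj L)} (hI : O.IsIdeal I)
    {A B : Type} [Finite A] [Finite B] :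
    (O.obj (Option A) ⧸ I (Option A)) →ₗ[K] (O.obj B ⧸ I B) →ₗ[K] (O.obj (A ⊕ B) ⧸ I (A ⊕ B)) :=
  (I (Option A)).liftQ
    (LinearMap.mk₂ K
      (fun x => (I B).mapQ (I (A ⊕ B)) (O.comp x) fun y hy => hI.comp_mem_right x y hy)
      (fun x x' y => by
        obtain ⟨y, rfl⟩ := (I B).mkQ_surjective y
        simp)
      (fun c x y => by
        obtain ⟨y, rfl⟩ := (I B).mkQ_surjective y
        simp)
      (fun x y y' => by simp)
      (fun c x y => by simp))
    (fun x hx => by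
      refine LinearMap.ext fun y => ?_
      obtain ⟨y, rfl⟩ := (I B).mkQ_surjective y
      simpa using hI.comp_mem_left x y hx)

theorem quotMap_mkQ (O : SymOperad.{u, v} K) {I : ∀ L : Type, Submodule K (O.obj L)}
    (hI : O.IsIdeal I) {L L' : Type} [Finite L] [Finite L'] (e : L ≃ L') (x : O.obj L) :
    O.quotMap hI e ((I L).mkQ x) = (I L').mkQ (O.map e x) := rfl

theorem quotComp_mkQ (O : SymOperad.{u, v} K) {I : ∀ L : Type, Submodule K (O.obj L)}
    (hI : O.IsIdeal I) {A B : Type} [Finite A] [Finite B] (x : O.obj (Option A)) (y : O.obj B) :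
    O.quotComp hI ((I (Option A)).mkQ x) ((I B).mkQ y) = (I (A ⊕ B)).mkQ (O.comp x y) := rfl

/-- The quotient of an operad by an operadic ideal. -/
def quot (O : SymOperad.{u, v} K) (I : ∀ L : Type, Submodule K (O.obj L)) (hI : O.IsIdeal I) :
    SymOperad.{u, v} K where
  obj L := O.obj L ⧸ I L
  map e := O.quotMap hI e
  unit := (I Unit).mkQ O.unit
  comp := O.quotComp hI
  map_refl {L} _ x := by
    obtain ⟨x, rfl⟩ := (I L).mkQ_surjective x
    rw [quotMap_mkQ, O.map_refl]
  map_trans {L _ _} _ _ _ e f x := by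
    obtain ⟨x, rfl⟩ := (I L).mkQ_surjective x
    simp only [quotMap_mkQ, O.map_trans]
  comp_map {A _ B _} _ _ _ _ e f x y := by
    obtain ⟨x, rfl⟩ := (I (Option A)).mkQ_surjective x
    obtain ⟨y, rfl⟩ := (I B).mkQ_surjective y
    simp only [quotMap_mkQ, quotComp_mkQ, O.comp_map]
  comp_seq {A B C} _ _ _ x y z := by
    obtain ⟨x, rfl⟩ := (I (Option A)).mkQ_surjective x
    obtain ⟨y, rfl⟩ := (I (Option B)).mkQ_surjective y
    obtain ⟨z, rfl⟩ := (I C).mkQ_surjective z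
    simp only [quotMap_mkQ, quotComp_mkQ, O.comp_seq]
  comp_par {A B C} _ _ _ x y z := by
    obtain ⟨x, rfl⟩ := (I (Option (Option A))).mkQ_surjective x
    obtain ⟨y, rfl⟩ := (I B).mkQ_surjective y
    obtain ⟨z, rfl⟩ := (I C).mkQ_surjective z
    simp only [quotMap_mkQ, quotComp_mkQ, O.comp_par x y z]
  unit_comp {B} _ y := by
    obtain ⟨y, rfl⟩ := (I B).mkQ_surjective y
    simp only [quotMap_mkQ, quotComp_mkQ, O.unit_comp]
  comp_unit {A} _ x := by
    obtain ⟨x, rfl⟩ := (I (Option A)).mkQ_surjective x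
    simp only [quotMap_mkQ, quotComp_mkQ, O.comp_unit]

/-- An algebra over an operad, on the vector space `A`: a morphism from the operad to the
endomorphism operad of `A`. -/
structure Algebra (O : SymOperad.{u, v} K) (A : Type w) [AddCommGroup A] [Module K A] where
  /-- the multilinear map given by an operation -/
  act : ∀ {L : Type} [Finite L], O.obj L →ₗ[K] MultilinearMap K (fun _ : L => A) A
  act_map : ∀ {L L' : Type} [Finite L] [Finite L'] (e : L ≃ L') (x : O.obj L) (a : L' → A),
    act (O.map e x) a = act x (fun l => a (e l))
  act_unit : ∀ a : Unit → A, act O.unit a = a ()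
  act_comp : ∀ {L M : Type} [Finite L] [Finite M] (x : O.obj (Option L)) (y : O.obj M)
    (a : L ⊕ M → A), act (O.comp x y) a =
      act x (fun o => o.elim (act y (fun m => a (Sum.inr m))) (fun l => a (Sum.inl l)))

/-- A linear map is a morphism of algebras over the operad. -/
def Algebra.IsHom {O : SymOperad.{u, v} K} {A : Type*} [AddCommGroup A] [Module K A]
    {B : Type*} [AddCommGroup B] [Module K B] (α : O.Algebra A) (β : O.Algebra B)
    (f : A →ₗ[K] B) : Prop :=
  ∀ (L : Type) [Finite L] (x : O.obj L) (a : L → A), f (α.act x a) = β.act x (fun l => f (a l))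

end SymOperad

/-! ### Free operads on binary operations without symmetry -/

/-- Planar binary trees, internal vertices decorated by `X`, leaves decorated by `L`. -/
inductive BTree (X : Type) (L : Type) : Type where
  | leaf (l : L) : BTree X L
  | node (x : X) (s t : BTree X L) : BTree X L

namespace BTree

variable {X L L' L'' A B : Type}

/-- Replace each leaf by a tree. -/
def bind : BTree X L → (L → BTree X L') → BTree X L'
  | leaf l, f => f l
  | node x s t, f => node x (s.bind f) (t.bind f)

/-- Relabel the leaves. -/
def map (f : L → L') (t : BTree X L) : BTree X L' := t.bind fun l => leaf (f l)

/-- The word of leaf labels, read from left to right. -/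
def leaves : BTree X L → List L
  | leaf l => [l]
  | node _ s t => s.leaves ++ t.leaves

/-- Graft the root of `t` on the leaves labelled `none` of `s`. -/
def graft (s : BTree X (Option A)) (t : BTree X B) : BTree X (A ⊕ B) :=
  s.bind fun o => o.elim (t.map Sum.inr) fun a => leaf (Sum.inl a)

theorem bind_leaf (t : BTree X L) : t.bind leaf = t := by
  induction t with
  | leaf l => rfl
  | node x s t hs ht => simp [bind, hs, ht]

theorem bind_bind (t : BTree X L) (f : L → BTree X L') (g : L' → BTree X L'') :
    (t.bind f).bind g = t.bind fun l => (f l).bind g := by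
  induction t with
  | leaf l => rfl
  | node x s t hs ht => simp [bind, hs, ht]

theorem leaves_bind (t : BTree X L) (f : L → BTree X L') :
    (t.bind f).leaves = t.leaves.flatMap fun l => (f l).leaves := by
  induction t with
  | leaf l => simp [bind, leaves]
  | node x s t hs ht => simp [bind, leaves, hs, ht]

theorem leaves_map (f : L → L') (t : BTree X L) : (t.map f).leaves = t.leaves.map f := by
  simp [map, leaves_bind, leaves, List.map_eq_flatMap]

end BTree

/-- Tree monomials with inputs `L`: each element of `L` labels exactly one leaf. -/
def TreeMonomial (X L : Type) : Type :=
  {t : BTree X L // t.leaves.Nodup ∧ ∀ l, l ∈ t.leaves}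

namespace TreeMonomial

variable {X L L' A B : Type}

/-- Relabelling along a bijection. -/
def map (e : L ≃ L') (t : TreeMonomial X L) : TreeMonomial X L' :=
  ⟨t.1.map e, by
    rw [BTree.leaves_map]
    exact ⟨t.2.1.map e.injective, fun l => List.mem_map.2 ⟨e.symm l, t.2.2 _, by simp⟩⟩⟩

/-- The trivial tree. -/
def unit : TreeMonomial X Unit := ⟨.leaf (), by simp [BTree.leaves]⟩

/-- Grafting of the second tree on the leaf `none` of the first one. -/
def graft (s : TreeMonomial X (Option A)) (t : TreeMonomial X B) : TreeMonomial X (A ⊕ B) :=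
  ⟨s.1.graft t.1, by
    rw [BTree.graft, BTree.leaves_bind]
    constructor
    · rw [List.nodup_flatMap]
      refine ⟨?_, s.2.1.imp ?_⟩
      · rintro (_ | a) _
        · simpa [BTree.leaves_map] using t.2.1.map Sum.inr_injective
        · simp [BTree.leaves]
      · rintro (_ | a) (_ | b) hab <;>
          simp_all [BTree.leaves_map, BTree.leaves, Function.onFun, eq_comm]
    · rintro (a | b)
      · exact List.mem_flatMap.2 ⟨some a, s.2.2 _, by simp [BTree.leaves]⟩
      · exact List.mem_flatMap.2 ⟨none, s.2.2 _, by simp [BTree.leaves_map, t.2.2 b]⟩⟩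

end TreeMonomial

open OperadAux in
/-- The free operad on the free `S_2`-module with basis `X`, that is, on one binary operation
without symmetry for each element of `X`. Its operations with inputs `L` have the tree monomials
with inputs `L` as a basis. -/
noncomputable def freeOperad (K : Type u) [Field K] (X : Type) : SymOperad.{u, u} K where
  obj L := TreeMonomial X L →₀ K
  map e := Finsupp.lmapDomain K K (TreeMonomial.map e)
  unit := Finsupp.single TreeMonomial.unit 1
  comp := Finsupp.lsum K fun s =>
    LinearMap.toSpanSingleton K _ (Finsupp.lmapDomain K K (TreeMonomial.graft s))
  map_refl x := by
    induction x using Finsupp.induction_linear with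
    | zero => simp
    | add f g hf hg => simp only [map_add, hf, hg]
    | single t c =>
      simp only [Finsupp.lmapDomain_apply, Finsupp.mapDomain_single]
      congr 1
      exact Subtype.ext (BTree.bind_leaf _)
  map_trans e f x := by
    induction x using Finsupp.induction_linear with
    | zero => simp
    | add f g hf hg => simp only [map_add, hf, hg]
    | single t c =>
      simp only [Finsupp.lmapDomain_apply, Finsupp.mapDomain_single]
      congr 1
      refine Subtype.ext ?_
      simp [TreeMonomial.map, BTree.map, BTree.bind_bind, BTree.bind]
  comp_map e f x y := by
    induction x using Finsupp.induction_linear with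
    | zero => simp
    | add f g hf hg => simp only [map_add, LinearMap.add_apply, hf, hg]
    | single s c =>
      induction y using Finsupp.induction_linear with
      | zero => simp
      | add f g hf hg => simp only [map_add, hf, hg]
      | single t d =>
        simp only [Finsupp.lmapDomain_apply, Finsupp.mapDomain_single, Finsupp.lsum_single,
          LinearMap.toSpanSingleton_apply, LinearMap.smul_apply, Finsupp.smul_single]
        congr 1
        refine Subtype.ext ?_
        simp only [TreeMonomial.map, TreeMonomial.graft, BTree.graft, BTree.map, BTree.bind_bind,
          BTree.bind]
        congr 1
        funext o
        rcases o with _ | a <;> simp [BTree.bind, BTree.bind_bind]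
  comp_seq x y z := by
    induction x using Finsupp.induction_linear with
    | zero => simp
    | add f g hf hg => simp only [map_add, LinearMap.add_apply, hf, hg]
    | single s c =>
      induction y using Finsupp.induction_linear with
      | zero => simp
      | add f g hf hg => simp only [map_add, LinearMap.add_apply, hf, hg]
      | single t d =>
        induction z using Finsupp.induction_linear with
        | zero => simp
        | add f g hf hg => simp only [map_add, hf, hg]
        | single r k =>
          simp only [Finsupp.lmapDomain_apply, Finsupp.mapDomain_single, Finsupp.lsum_single,
            LinearMap.toSpanSingleton_apply, LinearMap.smul_apply, Finsupp.smul_single]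
          rw [smul_eq_mul, smul_eq_mul, smul_eq_mul, smul_eq_mul, mul_assoc]
          congr 1
          refine Subtype.ext ?_
          simp only [TreeMonomial.map, TreeMonomial.graft, BTree.graft, BTree.map,
            BTree.bind_bind, BTree.bind]
          congr 1
          funext o
          rcases o with _ | a
          · simp only [Option.elim_none, BTree.bind_bind, BTree.bind]
            congr 1
            funext o
            rcases o with _ | b <;> simp [BTree.bind, BTree.bind_bind, sumOption]
          · simp [BTree.bind, sumOption]
  comp_par x y z := by
    induction x using Finsupp.induction_linear with
    | zero => simp
    | add f g hf hg => simp only [map_add, LinearMap.add_apply, hf, hg]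
    | single s c =>
      induction y using Finsupp.induction_linear with
      | zero => simp
      | add f g hf hg => simp only [map_add, LinearMap.add_apply, hf, hg]
      | single t d =>
        induction z using Finsupp.induction_linear with
        | zero => simp
        | add f g hf hg => simp only [map_add, LinearMap.add_apply, hf, hg]
        | single r k =>
          simp only [Finsupp.lmapDomain_apply, Finsupp.mapDomain_single, Finsupp.lsum_single,
            LinearMap.toSpanSingleton_apply, LinearMap.smul_apply, Finsupp.smul_single]
          rw [smul_eq_mul, smul_eq_mul, smul_eq_mul, smul_eq_mul, mul_right_comm]
          congr 1
          refine Subtype.ext ?_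
          simp only [TreeMonomial.map, TreeMonomial.graft, BTree.graft, BTree.map,
            BTree.bind_bind, BTree.bind]
          congr 1
          funext o
          rcases o with _ | (_ | a) <;>
            simp [BTree.bind, BTree.bind_bind, optionSum, optionSwap, sumSwapRight]
  unit_comp y := by
    induction y using Finsupp.induction_linear with
    | zero => simp
    | add f g hf hg => simp only [map_add, hf, hg]
    | single t d =>
      simp only [Finsupp.lmapDomain_apply, Finsupp.mapDomain_single, Finsupp.lsum_single,
        LinearMap.toSpanSingleton_apply, one_smul]
      rfl
  comp_unit x := by
    induction x using Finsupp.induction_linear with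
    | zero => simp
    | add f g hf hg => simp only [map_add, LinearMap.add_apply, hf, hg]
    | single s c =>
      simp only [Finsupp.lmapDomain_apply, Finsupp.mapDomain_single, Finsupp.lsum_single,
        LinearMap.toSpanSingleton_apply, LinearMap.smul_apply, Finsupp.smul_single]
      rw [smul_eq_mul, mul_one]
      congr 1
      refine Subtype.ext ?_
      simp only [TreeMonomial.map, TreeMonomial.graft, BTree.graft, BTree.map]
      congr 1
      funext o
      rcases o with _ | a <;> rfl

/-! ### Quadratic operads and Koszul duality -/

/-- The quadratic operad with generators `X` (a basis of the generating free `S_2`-module) and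
relations `R`. -/
noncomputable def quadraticOperad (K : Type u) [Field K] (X : Type)
    (R : Submodule K (TreeMonomial X (Fin 3) →₀ K)) : SymOperad.{u, u} K :=
  (freeOperad K X).quot ((freeOperad K X).idealSpan (R : Set (TreeMonomial X (Fin 3) →₀ K)))
    ((freeOperad K X).isIdeal_idealSpan _)

/-- The class of a tree monomial in a quadratic operad. -/
noncomputable def treeClass (K : Type u) [Field K] {X : Type}
    (R : Submodule K (TreeMonomial X (Fin 3) →₀ K)) {L : Type} (t : TreeMonomial X L) :
    (quadraticOperad K X R).obj L :=
  ((freeOperad K X).idealSpan (R : Set (TreeMonomial X (Fin 3) →₀ K)) L).mkQ (Finsupp.single t 1)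

/-- The number of inversions of a word. -/
def wordInversions {n : ℕ} : List (Fin n) → ℕ
  | [] => 0
  | a :: l => (l.filter fun b => b < a).length + wordInversions l

/-- The sign of the pairing on tree monomials with inputs `Fin 3`: the monomials `(a ∘₁ b)σ` get
the sign of `σ`, the monomials `(a ∘₂ b)σ` the opposite of the sign of `σ`. -/
def pairingSign {X : Type} : BTree X (Fin 3) → ℤ
  | .leaf _ => 1
  | .node x (.leaf a) t => - (-1) ^ wordInversions (BTree.node x (.leaf a) t).leaves
  | .node x (.node y r s) t => (-1) ^ wordInversions (BTree.node x (.node y r s) t).leaves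

/-- The pairing between `F(E^∨)(3)` and `F(E)(3)`, where `E` is the free `S_2`-module with basis `X`
and `E^∨ = E^* ⊗ sgn`. The module `E^∨` is free too, with the dual basis `(x^*)_{x ∈ X}` as
generators, and is identified with `E` through `x^* ↦ x`. As `x^* · (12)` takes the value `-1`
on `x · (12)`, the monomials `(a^* ∘₂ b^*)σ` and `(a ∘₂ b)σ`, whose root is read with its two
inputs exchanged, pair with an additional sign. -/
noncomputable def quadraticPairing (K : Type u) [Field K] (X : Type) :
    (TreeMonomial X (Fin 3) →₀ K) →ₗ[K] (TreeMonomial X (Fin 3) →₀ K) →ₗ[K] K :=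
  Finsupp.lsum K fun t =>
    LinearMap.toSpanSingleton K _ ((pairingSign t.1 : K) • Finsupp.lapply t)

/-- The orthogonal `R^⊥` of a space of quadratic relations. -/
noncomputable def orthogonalRelations (K : Type u) [Field K] (X : Type)
    (R : Submodule K (TreeMonomial X (Fin 3) →₀ K)) :
    Submodule K (TreeMonomial X (Fin 3) →₀ K) where
  carrier := {f | ∀ r ∈ R, quadraticPairing K X f r = 0}
  zero_mem' := fun r _ => by simp
  add_mem' := fun hf hg r hr => by rw [map_add, LinearMap.add_apply, hf r hr, hg r hr, add_zero]
  smul_mem' := fun c f hf r hr => by rw [map_smul, LinearMap.smul_apply, hf r hr, smul_zero]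

/-- The Koszul dual `F(E^∨)/(R^⊥)` of the quadratic operad `F(E)/(R)`. -/
noncomputable def koszulDual (K : Type u) [Field K] (X : Type)
    (R : Submodule K (TreeMonomial X (Fin 3) →₀ K)) : SymOperad.{u, u} K :=
  quadraticOperad K X (orthogonalRelations K X R)

/-! ### The operad `P_↗` and its Koszul dual -/

/-- The two generators: `m`, and `ne` for `↗`. -/
inductive NEGen : Type where
  | m : NEGen
  | ne : NEGen

/-- The monomial `a ∘ (b, I)`, that is, `a(b(x₁, x₂), x₃)`. -/
def leftMonomial {X : Type} (a b : X) : TreeMonomial X (Fin 3) :=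
  ⟨.node a (.node b (.leaf 0) (.leaf 1)) (.leaf 2), by
    simp only [BTree.leaves]; decide⟩

/-- The monomial `a ∘ (I, b)`, that is, `a(x₁, b(x₂, x₃))`. -/
def rightMonomial {X : Type} (a b : X) : TreeMonomial X (Fin 3) :=
  ⟨.node a (.leaf 0) (.node b (.leaf 1) (.leaf 2)), by
    simp only [BTree.leaves]; decide⟩

/-- The relator `a ∘ (b, I) - c ∘ (I, d)`. -/
noncomputable def relator (K : Type u) [Field K] {X : Type} (a b c d : X) :
    TreeMonomial X (Fin 3) →₀ K :=
  Finsupp.single (leftMonomial a b) 1 - Finsupp.single (rightMonomial c d) 1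

/-- The `S_3`-submodule of quadratic relations of `P_↗`, generated by
`↗ ∘ (↗, I) - ↗ ∘ (I, ↗)`, `m ∘ (↗, I) - ↗ ∘ (I, m)` and `m ∘ (m, I) - m ∘ (I, m)`. -/
noncomputable def neRelations (K : Type u) [Field K] :
    Submodule K (TreeMonomial NEGen (Fin 3) →₀ K) :=
  Submodule.span K {x | ∃ σ : Equiv.Perm (Fin 3),
    x = Finsupp.mapDomain (TreeMonomial.map σ) (relator K .ne .ne .ne .ne) ∨
    x = Finsupp.mapDomain (TreeMonomial.map σ) (relator K .m .ne .ne .m) ∨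
    x = Finsupp.mapDomain (TreeMonomial.map σ) (relator K .m .m .m .m)}

/-- The operad `P_↗`. -/
noncomputable def neOperad (K : Type u) [Field K] : SymOperad.{u, u} K :=
  quadraticOperad K NEGen (neRelations K)

/-- The Koszul dual `P_↗^!` of the operad `P_↗`. -/
noncomputable def neDual (K : Type u) [Field K] : SymOperad.{u, u} K :=
  koszulDual K NEGen (neRelations K)

/-- The element of `P_↗^!` given by a tree monomial. -/
noncomputable def neDualTree (K : Type u) [Field K] {L : Type} (t : TreeMonomial NEGen L) :
    (neDual K).obj L :=
  treeClass K (orthogonalRelations K NEGen (neRelations K)) t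

/-- The generators `m` and `↗` of `P_↗^!`, in arity `2`. -/
noncomputable def neDualGen (K : Type u) [Field K] (x : NEGen) : (neDual K).obj (Fin 2) :=
  neDualTree K ⟨.node x (.leaf 0) (.leaf 1), by simp only [BTree.leaves]; decide⟩

/-- The right comb `a₀(x₁, a₁(x₂, … a_{n-1}(xₙ, x_{n+1}) … ))`. -/
def rightComb {X : Type} : (n : ℕ) → (ℕ → X) → BTree X (Fin (n + 1))
  | 0, _ => .leaf 0
  | n + 1, a => .node (a 0) (.leaf 0) ((rightComb n fun j => a (j + 1)).map Fin.succ)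

theorem leaves_rightComb {X : Type} (n : ℕ) (a : ℕ → X) :
    (rightComb n a).leaves = List.finRange (n + 1) := by
  induction n generalizing a with
  | zero => rfl
  | succ n ih =>
    rw [List.finRange_succ, rightComb, BTree.leaves, BTree.leaves_map, ih]
    rfl

/-- The tree with `n + 1` leaves
`x₁ ↗ (x₂ ↗ ( … (x_i ↗ (x_{i+1} · (x_{i+2} · ( … · x_{n+1}) … ))) … ))`,
with `i` vertices `↗` followed by `n - i` vertices `m`, for `0 ≤ i ≤ n`. -/
def neComb (n : ℕ) (i : Fin (n + 1)) : TreeMonomial NEGen (Fin (n + 1)) :=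
  ⟨rightComb n fun j => if j < (i : ℕ) then .ne else .m, by
    rw [leaves_rightComb]
    exact ⟨List.nodup_finRange _, List.mem_finRange⟩⟩

/-! ### The algebra `T_↗(V)` -/

section NETensor

variable (K : Type u) [Field K] (V : Type v) [AddCommGroup V] [Module K V]

/-- `T_↗(V)`, the direct sum over `n ≥ 1` of `n` copies of `V^{⊗ n}` (there is no index `(0, k)`).
The copy `(n, k)`, with `0 ≤ k < n`, holds the tensors whose first `k` tensor signs are marked. -/
abbrev NETensor : Type (max u v) :=
  DirectSum (Σ n : ℕ, Fin n) fun p => TensorPower K p.1 V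

/-- The bilinear map on `T_↗(V)` that concatenates tensors of the copies `p` and `q` and puts the
result into the copy `c p q`, if `P p q` holds, and is `0` on these copies otherwise. -/
noncomputable def NETensor.concat (P : (Σ n : ℕ, Fin n) → (Σ n : ℕ, Fin n) → Prop)
    [∀ p q, Decidable (P p q)] (c : ∀ p q : Σ n : ℕ, Fin n, Fin (p.1 + q.1)) :
    NETensor K V →ₗ[K] NETensor K V →ₗ[K] NETensor K V :=
  DirectSum.toModule K _ _ fun p => LinearMap.flip <| DirectSum.toModule K _ _ fun q =>
    if P p q then
      LinearMap.flip <| (TensorProduct.mk K (TensorPower K p.1 V) (TensorPower K q.1 V)).compr₂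
        ((DirectSum.lof K (Σ n : ℕ, Fin n) (fun p => TensorPower K p.1 V)
            ⟨p.1 + q.1, c p q⟩).comp
          (TensorPower.mulEquiv : _ ≃ₗ[K] TensorPower K (p.1 + q.1) V).toLinearMap)
    else 0

/-- The product `m`: it is `0` if the right factor has a marked sign; otherwise the tensors are
joined by an unmarked sign. -/
noncomputable def NETensor.mul : NETensor K V →ₗ[K] NETensor K V →ₗ[K] NETensor K V :=
  NETensor.concat K V (fun _ q => (q.2 : ℕ) = 0) (fun p q => Fin.castAdd q.1 p.2)

/-- The product `↗`: it is `0` if the left factor has an unmarked sign; otherwise the tensors are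
joined by a marked sign. -/
noncomputable def NETensor.ne : NETensor K V →ₗ[K] NETensor K V →ₗ[K] NETensor K V :=
  NETensor.concat K V (fun p _ => (p.2 : ℕ) + 1 = p.1) (fun p q => Fin.natAdd p.1 q.2)

/-- The inclusion of `V` as the component of degree `1`. -/
noncomputable def NETensor.ι : V →ₗ[K] NETensor K V :=
  (DirectSum.lof K (Σ n : ℕ, Fin n) (fun p => TensorPower K p.1 V) ⟨1, 0⟩).comp
    (PiTensorProduct.subsingletonEquiv (s := fun _ : Fin 1 => V) (0 : Fin 1)).symm.toLinearMap

end NETensor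

/-! For each permutation of the labels there are eight tree monomials of arity three. The three
relators of `P_↗` involve six of them, each relator one left and one right monomial, and the pairing
has opposite signs on these two. Hence `R^⊥` contains the same three relators, together with the two
monomials found in no relator, `↗ ∘ (m, I)` and `m ∘ (I, ↗)`. A `P_↗^!`-algebra therefore carries
two products with the three relations of `P_↗` and moreover `(x · y) ↗ z = 0` and `x · (y ↗ z) = 0`.

Upper bound: oriented from left to right, the three relations turn every tree into a right comb, and
the two monomial relations kill it unless its vertices `↗` precede its vertices `m`. So the `n · n!`
relabelled combs span (`reducesToNEComb`, `span_neComb`).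

Lower bound: `T_↗(V)` satisfies the relations (`neDualRelations_op`), and a comb evaluated on
vectors of `V` is the word of these vectors in the copy that records its number of vertices `↗`
(`eval_neComb`). For `V = K^n`, evaluation on the standard basis sends distinct relabelled combs to
distinct basis words, which gives independence (`linearIndependent_neComb`). Since `S_n` permutes
this basis freely, with the combs as representatives of the orbits, the module is free.

Universal property: words are combs in elements of `V`, so a morphism is determined by its
restriction to `V`. Conversely, send each word to the value of its comb in `A`. Because combs span,
this map is compatible with every operation applied to elements of `V` (`lift_act`). A product of
two words is such a value, so the map preserves both products and is a morphism. -/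

namespace BTree

/-! ### Trees and their labels -/

variable {X L L' L'' A B : Type}

theorem map_map (f : L → L') (g : L' → L'') (t : BTree X L) :
    (t.map f).map g = t.map (g ∘ f) := by
  simp [map, bind_bind, bind]

theorem map_id (t : BTree X L) : t.map id = t := bind_leaf t

/-- A tree is determined by the tree of images of its labels together with its word of labels. -/
theorem map_eq_of_leaves_map_eq {s : BTree X A} {t : BTree X B} {f : A → L} {g : B → L}
    {e : A → B} (h : s.map f = t.map g) (he : s.leaves.map e = t.leaves) : s.map e = t := by
  induction s generalizing t with
  | leaf a =>
    cases t with
    | leaf b => simpa [leaves, map, bind] using he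
    | node => simp [map, bind] at h
  | node x s₁ s₂ h₁ h₂ =>
    cases t with
    | leaf b => simp [map, bind] at h
    | node y t₁ t₂ =>
      change node x (s₁.map f) (s₂.map f) = node y (t₁.map g) (t₂.map g) at h
      injection h with hx hl hr
      subst hx
      -- Equal shapes give equal numbers of leaves, so the equality of the concatenated words splits
      -- at the root.
      have hlen : (s₁.leaves.map e).length = t₁.leaves.length := by
        have := congrArg (fun t => t.leaves.length) hl
        simpa [leaves_map] using this
      rw [leaves, List.map_append, leaves] at he
      obtain ⟨e₁, e₂⟩ := List.append_inj he hlen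
      change node x (s₁.map e) (s₂.map e) = _
      rw [h₁ hl e₁, h₂ hr e₂]

theorem leaves_ne_nil (t : BTree X L) : t.leaves ≠ [] := by
  induction t <;> simp_all [leaves]

end BTree

namespace TreeMonomial

variable {X L L' L'' A B C : Type}

/-- Two tree monomials with the same image under relabellings differ by a bijection of the
labels. -/
theorem exists_equiv_of_map_eq {s : TreeMonomial X A} {t : TreeMonomial X B} {f : A → L}
    {g : B → L} (h : s.1.map f = t.1.map g) :
    ∃ e : A ≃ B, s.map e = t ∧ g ∘ e = f := by
  classical
  have hl : s.1.leaves.map f = t.1.leaves.map g := by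
    simpa [BTree.leaves_map] using congrArg BTree.leaves h
  have hlen : s.1.leaves.length = t.1.leaves.length := by simpa using congrArg List.length hl
  -- The bijection matches the labels of the leaves at the same position from the left.
  let e : A ≃ B := ((s.2.1.getEquivOfForallMemList _ s.2.2).symm.trans (finCongr hlen)).trans
    (t.2.1.getEquivOfForallMemList _ t.2.2)
  have he : s.1.leaves.map e = t.1.leaves := by
    refine List.ext_getElem (by simpa using hlen) fun i h₁ h₂ => ?_
    have hi : i < s.1.leaves.length := by simpa using h₁
    have : s.1.leaves[i] = s.2.1.getEquivOfForallMemList _ s.2.2 ⟨i, hi⟩ := rfl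
    rw [List.getElem_map, this]
    simp only [e, Equiv.trans_apply, Equiv.symm_apply_apply]
    rfl
  refine ⟨e, Subtype.ext (BTree.map_eq_of_leaves_map_eq h he), funext fun a => ?_⟩
  rw [← he, List.map_map] at hl
  exact (List.map_inj_left.1 hl a (s.2.2 a)).symm

/-- The tree monomial with root `x` and with subtrees `s` and `t`. -/
def node (x : X) (s : TreeMonomial X A) (t : TreeMonomial X B) : TreeMonomial X (A ⊕ B) :=
  ⟨.node x (s.1.map Sum.inl) (t.1.map Sum.inr), by
    simp only [BTree.leaves, BTree.leaves_map]
    refine ⟨(s.2.1.map Sum.inl_injective).append (t.2.1.map Sum.inr_injective) ?_, ?_⟩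
    · intro a ha hb
      simp only [List.mem_map] at ha hb
      obtain ⟨a, -, rfl⟩ := ha
      obtain ⟨b, -, hb⟩ := hb
      cases hb
    · rintro (a | b) <;> simp [s.2.2, t.2.2]⟩

/-- The tree monomial with one vertex, with inputs `Option Unit`. -/
def vertex (x : X) : TreeMonomial X (Option Unit) :=
  ⟨.node x (.leaf none) (.leaf (some ())), by
    simp only [BTree.leaves]
    exact ⟨by simp, by rintro (_ | _) <;> simp⟩⟩

/-- The tree monomial with one vertex, with inputs `Fin 2`. -/
def corolla (x : X) : TreeMonomial X (Fin 2) :=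
  ⟨.node x (.leaf 0) (.leaf 1), by simp only [BTree.leaves]; decide⟩

/-- `Unit ⊕ A ≃ Option A`. -/
def unitSumEquiv (A : Type) : Unit ⊕ A ≃ Option A where
  toFun s := s.elim (fun _ => none) some
  invFun o := o.elim (.inl ()) .inr
  left_inv := by rintro (_ | a) <;> rfl
  right_inv := by rintro (_ | a) <;> rfl

/-- `(Unit ⊕ A) ⊕ B ≃ Option (A ⊕ B)`. -/
def unitSumSumEquiv (A B : Type) : (Unit ⊕ A) ⊕ B ≃ Option (A ⊕ B) :=
  (Equiv.sumAssoc Unit A B).trans (unitSumEquiv (A ⊕ B))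

/-- `Fin 2 ≃ Option Unit`, where `0` is the added point. -/
def finTwoEquivOption : Fin 2 ≃ Option Unit where
  toFun i := ![none, some ()] i
  invFun o := o.elim 0 fun _ => 1
  left_inv i := by fin_cases i <;> rfl
  right_inv := by rintro (_ | _) <;> rfl

/-- `Fin 3 ≃ Option (Option Unit)`, where `0` and `1` are the added points. -/
def finThreeEquivOption : Fin 3 ≃ Option (Option Unit) where
  toFun i := ![none, some none, some (some ())] i
  invFun o := o.elim 0 fun o => o.elim 1 fun _ => 2
  left_inv i := by fin_cases i <;> rfl
  right_inv := by rintro (_ | _ | _) <;> rfl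

theorem map_corolla (x : X) : (corolla x).map finTwoEquivOption = vertex x := rfl

/-- Only partial composition is available in an operad, so the two subtrees are plugged in one after
the other; this transfers inductions on trees to any quotient operad. -/
theorem node_eq_graft (x : X) (s : TreeMonomial X A) (t : TreeMonomial X B) :
    node x s t = graft (map (unitSumEquiv A) (graft (vertex x) s)) t := by
  refine Subtype.ext ?_
  simp [node, graft, map, BTree.graft, BTree.map, vertex, BTree.bind, BTree.bind_bind,
    unitSumEquiv]

/-- Plugging three tree monomials into the leaves of a tree monomial with inputs `Fin 3`. -/
def graftThree (q : TreeMonomial X (Fin 3)) (r : TreeMonomial X A) (s : TreeMonomial X B)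
    (t : TreeMonomial X C) : TreeMonomial X ((A ⊕ B) ⊕ C) :=
  graft (map (unitSumSumEquiv A B)
    (graft (map (OperadAux.optionSum Unit A) (graft (map finThreeEquivOption q) r)) s)) t

theorem graftThree_leftMonomial (a b : X) (r : TreeMonomial X A) (s : TreeMonomial X B)
    (t : TreeMonomial X C) : graftThree (leftMonomial a b) r s t = node a (node b r s) t := by
  refine Subtype.ext ?_
  simp [graftThree, leftMonomial, node, graft, map, BTree.graft, BTree.map, BTree.bind,
    BTree.bind_bind, unitSumSumEquiv, unitSumEquiv, finThreeEquivOption, OperadAux.optionSum]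

/-- The reassociation of labels gives both sides of a quadratic relation the same input set after
substitution. -/
theorem graftThree_rightMonomial (a b : X) (r : TreeMonomial X A) (s : TreeMonomial X B)
    (t : TreeMonomial X C) : graftThree (rightMonomial a b) r s t =
      map (Equiv.sumAssoc A B C).symm (node a r (node b s t)) := by
  refine Subtype.ext ?_
  simp [graftThree, rightMonomial, node, graft, map, BTree.graft, BTree.map, BTree.bind,
    BTree.bind_bind, unitSumSumEquiv, unitSumEquiv, finThreeEquivOption, OperadAux.optionSum]

end TreeMonomial

/-- Every tree is the image of a tree monomial under a relabelling. -/
theorem BTree.exists_treeMonomial {X L : Type} (t : BTree X L) :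
    ∃ (A : Type) (_ : Finite A) (f : A → L) (t' : TreeMonomial X A), t'.1.map f = t := by
  induction t with
  | leaf l => exact ⟨Unit, inferInstance, fun _ => l, .unit, rfl⟩
  | node x s t hs ht =>
    obtain ⟨A, _, f, s', rfl⟩ := hs
    obtain ⟨B, _, g, t', rfl⟩ := ht
    refine ⟨A ⊕ B, inferInstance, Sum.elim f g, s'.node x t', ?_⟩
    change BTree.node x ((s'.1.map _).map _) ((t'.1.map _).map _) = _
    rw [BTree.map_map, BTree.map_map, Sum.elim_comp_inl, Sum.elim_comp_inr]

/-! ### Rewriting of trees in a quadratic operad -/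

section QuadraticOperad

open TreeMonomial

variable {K : Type u} [Field K] {X : Type} {R : Submodule K (TreeMonomial X (Fin 3) →₀ K)}
  {L L' A B C : Type}

variable (R) in
/-- The projection of the free operad onto a quadratic operad. -/
noncomputable def quadraticMk (L : Type) :
    (TreeMonomial X L →₀ K) →ₗ[K] (quadraticOperad K X R).obj L where
  toFun f := Submodule.Quotient.mk f
  map_add' _ _ := rfl
  map_smul' _ _ := rfl

theorem quadraticMk_single_one (t : TreeMonomial X L) :
    quadraticMk R L (Finsupp.single t 1) = treeClass K R t := rfl

variable (R) in
theorem quadraticMk_surjective (L : Type) : Function.Surjective (quadraticMk R L) :=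
  Submodule.mkQ_surjective _

theorem quadraticMk_eq_zero_of_mem {f : TreeMonomial X (Fin 3) →₀ K} (hf : f ∈ R) :
    quadraticMk R (Fin 3) f = 0 :=
  (Submodule.Quotient.mk_eq_zero _).2
    ((SymOperad.mem_idealSpan (freeOperad K X) _).2 fun _ _ h => h hf)

theorem quadraticOperad_map_mk [Finite L] [Finite L'] (e : L ≃ L') (f : TreeMonomial X L →₀ K) :
    (quadraticOperad K X R).map e (quadraticMk R L f) =
      quadraticMk R L' (f.mapDomain (TreeMonomial.map e)) := rfl

theorem quadraticOperad_map_treeClass [Finite L] [Finite L'] (e : L ≃ L') (t : TreeMonomial X L) :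
    (quadraticOperad K X R).map e (treeClass K R t) = treeClass K R (t.map e) := by
  rw [← quadraticMk_single_one, quadraticOperad_map_mk, Finsupp.mapDomain_single,
    quadraticMk_single_one]

theorem freeOperad_comp_single [Finite A] [Finite B] (s : TreeMonomial X (Option A))
    (t : TreeMonomial X B) :
    (freeOperad K X).comp (Finsupp.single s (1 : K)) (Finsupp.single t (1 : K)) =
      (Finsupp.single (s.graft t) (1 : K) : TreeMonomial X (A ⊕ B) →₀ K) := by
  -- This is the goal with the composition of the free operad unfolded.
  have : Finsupp.lsum K (fun s => LinearMap.toSpanSingleton K _ (Finsupp.lmapDomain K K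
      (TreeMonomial.graft (X := X) (A := A) (B := B) s))) (Finsupp.single s (1 : K))
      (Finsupp.single t (1 : K)) = Finsupp.single (s.graft t) (1 : K) := by
    rw [Finsupp.lsum_single, LinearMap.toSpanSingleton_apply, one_smul,
      Finsupp.lmapDomain_apply, Finsupp.mapDomain_single]
  exact this

theorem quadraticOperad_comp_treeClass [Finite A] [Finite B] (s : TreeMonomial X (Option A))
    (t : TreeMonomial X B) :
    (quadraticOperad K X R).comp (treeClass K R s) (treeClass K R t) =
      treeClass K R (s.graft t) :=
  congrArg (quadraticMk R (A ⊕ B)) (freeOperad_comp_single s t)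

variable (R) in
theorem span_range_treeClass (L : Type) :
    Submodule.span K (Set.range fun t : TreeMonomial X L => treeClass K R t) = ⊤ := by
  refine Submodule.eq_top_iff'.2 fun x => ?_
  obtain ⟨f, rfl⟩ := quadraticMk_surjective R L x
  induction f using Finsupp.induction_linear with
  | zero => rw [map_zero]; exact zero_mem _
  | add f g hf hg => rw [map_add]; exact add_mem hf hg
  | single t c =>
    rw [← mul_one c, ← smul_eq_mul, ← Finsupp.smul_single, map_smul, quadraticMk_single_one]
    exact Submodule.smul_mem _ _ (Submodule.subset_span ⟨t, rfl⟩)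

theorem treeClass_node [Finite A] [Finite B] (x : X) (s : TreeMonomial X A)
    (t : TreeMonomial X B) :
    treeClass K R (s.node x t) = (quadraticOperad K X R).comp
      ((quadraticOperad K X R).map (unitSumEquiv A)
        ((quadraticOperad K X R).comp (treeClass K R (vertex x)) (treeClass K R s)))
      (treeClass K R t) := by
  rw [quadraticOperad_comp_treeClass, quadraticOperad_map_treeClass,
    quadraticOperad_comp_treeClass, node_eq_graft]

/-- Partial composition is bilinear, so scalars come out of both subtrees. This is what makes
rewriting possible below the root. -/
theorem treeClass_node_congr [Finite A] [Finite B] (x : X) {s s' : TreeMonomial X A}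
    {t t' : TreeMonomial X B} {c d : K} (hs : treeClass K R s = c • treeClass K R s')
    (ht : treeClass K R t = d • treeClass K R t') :
    treeClass K R (s.node x t) = (c * d) • treeClass K R (s'.node x t') := by
  rw [treeClass_node, hs, ht, map_smul, map_smul, map_smul, map_smul, LinearMap.smul_apply,
    smul_smul, mul_comm d c, ← treeClass_node]

/-- Substitution of three tree monomials into operations with inputs `Fin 3`. -/
theorem exists_graftThree_linearMap [Finite A] [Finite B] [Finite C] (r : TreeMonomial X A)
    (s : TreeMonomial X B) (t : TreeMonomial X C) :
    ∃ G : (quadraticOperad K X R).obj (Fin 3) →ₗ[K] (quadraticOperad K X R).obj ((A ⊕ B) ⊕ C),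
      ∀ q, G (treeClass K R q) = treeClass K R (graftThree q r s t) := by
  let Q := quadraticOperad K X R
  let G₁ := (Q.map (OperadAux.optionSum Unit A)) ∘ₗ (Q.comp.flip (treeClass K R r)) ∘ₗ
    Q.map finThreeEquivOption
  let G₂ := (Q.map (unitSumSumEquiv A B)) ∘ₗ (Q.comp.flip (treeClass K R s)) ∘ₗ G₁
  refine ⟨(Q.comp.flip (treeClass K R t)) ∘ₗ G₂, fun q => ?_⟩
  simp only [G₂, G₁, LinearMap.comp_apply, LinearMap.flip_apply, Q, quadraticOperad_map_treeClass,
    quadraticOperad_comp_treeClass, graftThree]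

theorem treeClass_eq_of_sub_mem {p q : TreeMonomial X (Fin 3)}
    (h : Finsupp.single p 1 - Finsupp.single q 1 ∈ R) : treeClass K R p = treeClass K R q := by
  rw [← sub_eq_zero, ← quadraticMk_single_one, ← quadraticMk_single_one, ← map_sub,
    quadraticMk_eq_zero_of_mem h]

theorem treeClass_eq_zero_of_mem {p : TreeMonomial X (Fin 3)}
    (h : Finsupp.single p 1 ∈ R) : treeClass K R p = 0 := quadraticMk_eq_zero_of_mem h

variable (R) in
/-- The tree `s` equals `c` times the tree `t` in the quadratic operad, for any labelling that
makes them tree monomials. -/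
def Reduces (s : BTree X L) (c : K) (t : BTree X L) : Prop :=
  ∃ (A : Type) (_ : Finite A) (f : A → L) (s' t' : TreeMonomial X A),
    s'.1.map f = s ∧ t'.1.map f = t ∧ treeClass K R s' = c • treeClass K R t'

namespace Reduces

theorem refl (s : BTree X L) : Reduces R s 1 s := by
  obtain ⟨A, _, f, s', h⟩ := s.exists_treeMonomial
  exact ⟨A, ‹_›, f, s', s', h, h, (one_smul _ _).symm⟩

/-- The two hypotheses may present the middle tree by different label sets. The presentations differ
by a bijection, and equivariance carries the second reduction along it. -/
theorem trans {r s t : BTree X L} {c d : K} (h₁ : Reduces R r c s) (h₂ : Reduces R s d t) :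
    Reduces R r (c * d) t := by
  obtain ⟨A, _, f, r', s', rfl, hs, h⟩ := h₁
  obtain ⟨B, _, g, s'', t', hs', rfl, h'⟩ := h₂
  obtain ⟨e, he, hf⟩ := exists_equiv_of_map_eq (hs'.trans hs.symm)
  refine ⟨A, ‹_›, f, r', t'.map e, rfl, ?_, ?_⟩
  · rw [← hf]; exact BTree.map_map _ _ _
  · rw [h, ← he, ← quadraticOperad_map_treeClass, h', map_smul, smul_smul,
      quadraticOperad_map_treeClass]

theorem node (x : X) {s s' t t' : BTree X L} {c d : K} (h₁ : Reduces R s c s')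
    (h₂ : Reduces R t d t') : Reduces R (.node x s t) (c * d) (.node x s' t') := by
  obtain ⟨A, _, f, s₁, s₂, rfl, rfl, h⟩ := h₁
  obtain ⟨B, _, g, t₁, t₂, rfl, rfl, h'⟩ := h₂
  refine ⟨A ⊕ B, inferInstance, Sum.elim f g, s₁.node x t₁, s₂.node x t₂, ?_, ?_,
    treeClass_node_congr x h h'⟩
  all_goals
    refine congrArg₂ (BTree.node x) ?_ ?_ <;> exact BTree.map_map _ _ _

/-- With disjoint labels chosen for the three subtrees, substitution is a linear map on operations
of arity three, hence carries the relation to the substituted trees. -/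
theorem of_sub_mem {a b c d : X}
    (h : Finsupp.single (leftMonomial a b) 1 - Finsupp.single (rightMonomial c d) 1 ∈ R)
    (r s t : BTree X L) :
    Reduces R (.node a (.node b r s) t) 1 (.node c r (.node d s t)) := by
  obtain ⟨A, _, f, r, rfl⟩ := r.exists_treeMonomial
  obtain ⟨B, _, g, s, rfl⟩ := s.exists_treeMonomial
  obtain ⟨C, _, k, t, rfl⟩ := t.exists_treeMonomial
  obtain ⟨G, hG⟩ := exists_graftThree_linearMap (R := R) r s t
  refine ⟨_, inferInstance, Sum.elim (Sum.elim f g) k, graftThree (leftMonomial a b) r s t,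
    graftThree (rightMonomial c d) r s t, ?_, ?_, ?_⟩
  · rw [graftThree_leftMonomial]
    simp only [TreeMonomial.node, BTree.map, BTree.bind, BTree.bind_bind]
    rfl
  · rw [graftThree_rightMonomial]
    simp only [TreeMonomial.node, TreeMonomial.map, BTree.map, BTree.bind, BTree.bind_bind]
    rfl
  · rw [← hG, ← hG, treeClass_eq_of_sub_mem h, one_smul]

/-- Vanishing is expressed as reduction of the tree to itself with scalar `0`, so that it propagates
like any other reduction. -/
theorem of_leftMonomial_mem {a b : X} (h : Finsupp.single (leftMonomial a b) 1 ∈ R)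
    (r s t : BTree X L) :
    Reduces R (.node a (.node b r s) t) 0 (.node a (.node b r s) t) := by
  obtain ⟨A, _, f, r, rfl⟩ := r.exists_treeMonomial
  obtain ⟨B, _, g, s, rfl⟩ := s.exists_treeMonomial
  obtain ⟨C, _, k, t, rfl⟩ := t.exists_treeMonomial
  obtain ⟨G, hG⟩ := exists_graftThree_linearMap (R := R) r s t
  have h' : (graftThree (leftMonomial a b) r s t).1.map (Sum.elim (Sum.elim f g) k) =
      .node a (.node b (r.1.map f) (s.1.map g)) (t.1.map k) := by
    rw [graftThree_leftMonomial]
    simp only [TreeMonomial.node, BTree.map, BTree.bind, BTree.bind_bind]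
    rfl
  refine ⟨_, inferInstance, Sum.elim (Sum.elim f g) k, _, _, h', h', ?_⟩
  rw [← hG, treeClass_eq_zero_of_mem h, map_zero, smul_zero]

theorem of_rightMonomial_mem {a b : X} (h : Finsupp.single (rightMonomial a b) 1 ∈ R)
    (r s t : BTree X L) :
    Reduces R (.node a r (.node b s t)) 0 (.node a r (.node b s t)) := by
  obtain ⟨A, _, f, r, rfl⟩ := r.exists_treeMonomial
  obtain ⟨B, _, g, s, rfl⟩ := s.exists_treeMonomial
  obtain ⟨C, _, k, t, rfl⟩ := t.exists_treeMonomial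
  obtain ⟨G, hG⟩ := exists_graftThree_linearMap (R := R) r s t
  have h' : (graftThree (rightMonomial a b) r s t).1.map (Sum.elim (Sum.elim f g) k) =
      .node a (r.1.map f) (.node b (s.1.map g) (t.1.map k)) := by
    rw [graftThree_rightMonomial]
    simp only [TreeMonomial.node, TreeMonomial.map, BTree.map, BTree.bind, BTree.bind_bind]
    rfl
  refine ⟨_, inferInstance, Sum.elim (Sum.elim f g) k, _, _, h', h', ?_⟩
  rw [← hG, treeClass_eq_zero_of_mem h, map_zero, smul_zero]

/-- This is the way back from rewriting to an identity between operations with inputs `L`. -/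
theorem treeClass_eq [Finite L] {s : TreeMonomial X L} {c : K} {t : BTree X L}
    (h : Reduces R s.1 c t) :
    ∃ t' : TreeMonomial X L, t'.1 = t ∧ treeClass K R s = c • treeClass K R t' := by
  obtain ⟨A, _, f, s', t', hs, rfl, h⟩ := h
  obtain ⟨e, rfl, hf⟩ := exists_equiv_of_map_eq (hs.trans s.1.map_id.symm)
  refine ⟨t'.map e, ?_, ?_⟩
  · rw [← hf]; rfl
  · rw [← quadraticOperad_map_treeClass, h, map_smul, quadraticOperad_map_treeClass]

end Reduces

end QuadraticOperad

/-! ### Evaluation of trees, and algebras from bilinear operations -/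

namespace BTree

variable {K : Type u} [Field K] {X L L' : Type} {M : Type w} [AddCommGroup M] [Module K M]

/-- Evaluation of a tree in a vector space with bilinear operations. -/
def eval (op : X → M →ₗ[K] M →ₗ[K] M) : BTree X L → (L → M) → M
  | leaf l, a => a l
  | node x s t, a => op x (s.eval op a) (t.eval op a)

variable (op : X → M →ₗ[K] M →ₗ[K] M)

theorem eval_bind (t : BTree X L) (f : L → BTree X L') (a : L' → M) :
    (t.bind f).eval op a = t.eval op fun l => (f l).eval op a := by
  induction t with
  | leaf l => rfl
  | node x s t hs ht => simp only [bind, eval, hs, ht]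

theorem eval_map (t : BTree X L) (f : L → L') (a : L' → M) :
    (t.map f).eval op a = t.eval op (a ∘ f) := eval_bind op t _ a

theorem eval_congr {t : BTree X L} {a b : L → M} (h : ∀ l ∈ t.leaves, a l = b l) :
    t.eval op a = t.eval op b := by
  induction t with
  | leaf l => exact h l (by simp [leaves])
  | node x s t hs ht =>
    simp only [leaves, List.mem_append] at h
    simp only [eval]
    rw [hs fun l hl => h l (.inl hl), ht fun l hl => h l (.inr hl)]

theorem eval_update_of_notMem [DecidableEq L] {t : BTree X L} (a : L → M) {l : L} (x : M)
    (h : l ∉ t.leaves) : t.eval op (Function.update a l x) = t.eval op a :=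
  eval_congr op fun k hk => Function.update_of_ne (by rintro rfl; exact h hk) _ _

/-- The label occurs on exactly one leaf: at each vertex it lies in one subtree, and the value of
the other is unaffected. -/
theorem eval_update_add [DecidableEq L] {t : BTree X L} (ht : t.leaves.Nodup) (a : L → M) {l : L}
    (hl : l ∈ t.leaves) (x y : M) :
    t.eval op (Function.update a l (x + y)) =
      t.eval op (Function.update a l x) + t.eval op (Function.update a l y) := by
  induction t with
  | leaf k =>
    obtain rfl : l = k := by simpa [leaves] using hl
    simp [eval]
  | node z s t hs ht' =>
    simp only [leaves, List.nodup_append'] at ht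
    rw [leaves, List.mem_append] at hl
    simp only [eval]
    rcases hl with hl | hl
    · have := List.disjoint_left.1 ht.2.2 hl
      rw [hs ht.1 hl, map_add, LinearMap.add_apply]
      simp only [eval_update_of_notMem op a _ this]
    · have : l ∉ s.leaves := fun h => List.disjoint_left.1 ht.2.2 h hl
      rw [ht' ht.2.1 hl, map_add]
      simp only [eval_update_of_notMem op a _ this]

theorem eval_update_smul [DecidableEq L] {t : BTree X L} (ht : t.leaves.Nodup) (a : L → M) {l : L}
    (hl : l ∈ t.leaves) (c : K) (x : M) :
    t.eval op (Function.update a l (c • x)) = c • t.eval op (Function.update a l x) := by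
  induction t with
  | leaf k =>
    obtain rfl : l = k := by simpa [leaves] using hl
    simp [eval]
  | node z s t hs ht' =>
    simp only [leaves, List.nodup_append'] at ht
    rw [leaves, List.mem_append] at hl
    simp only [eval]
    rcases hl with hl | hl
    · have := List.disjoint_left.1 ht.2.2 hl
      rw [hs ht.1 hl, map_smul, LinearMap.smul_apply]
      simp only [eval_update_of_notMem op a _ this]
    · have : l ∉ s.leaves := fun h => List.disjoint_left.1 ht.2.2 h hl
      rw [ht' ht.2.1 hl, map_smul]
      simp only [eval_update_of_notMem op a _ this]

end BTree

section AlgebraOfOperations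

open TreeMonomial

variable {K : Type u} [Field K] {X L L' A B : Type} {M : Type w} [AddCommGroup M] [Module K M]
  (op : X → M →ₗ[K] M →ₗ[K] M)

/-- Evaluation of a tree monomial, as a multilinear map. -/
def TreeMonomial.evalMultilinear (t : TreeMonomial X L) :
    MultilinearMap K (fun _ : L => M) M where
  toFun a := t.1.eval op a
  map_update_add' a l x y := BTree.eval_update_add op t.2.1 a (t.2.2 l) x y
  map_update_smul' a l c x := BTree.eval_update_smul op t.2.1 a (t.2.2 l) c x

/-- Linear combinations of tree monomials as multilinear maps. -/
noncomputable def freeAct (L : Type) :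
    (TreeMonomial X L →₀ K) →ₗ[K] MultilinearMap K (fun _ : L => M) M :=
  Finsupp.linearCombination K (TreeMonomial.evalMultilinear op)

theorem freeAct_single (t : TreeMonomial X L) (c : K) (a : L → M) :
    freeAct op L (Finsupp.single t c) a = c • t.1.eval op a := by
  rw [freeAct, Finsupp.linearCombination_single]
  rfl

theorem freeAct_map (e : L ≃ L') (f : TreeMonomial X L →₀ K) (a : L' → M) :
    freeAct op L' (f.mapDomain (TreeMonomial.map e)) a = freeAct op L f (a ∘ e) := by
  induction f using Finsupp.induction_linear with
  | zero => simp
  | add f g hf hg => simp only [Finsupp.mapDomain_add, map_add, add_apply, hf, hg]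
  | single t c =>
    rw [Finsupp.mapDomain_single, freeAct_single, freeAct_single]
    exact congrArg _ (BTree.eval_map op t.1 e a)

/-- Partial composition in the free operad. -/
noncomputable def freeComp (K : Type u) [Field K] (X A B : Type) :
    (TreeMonomial X (Option A) →₀ K) →ₗ[K] (TreeMonomial X B →₀ K) →ₗ[K]
      (TreeMonomial X (A ⊕ B) →₀ K) :=
  Finsupp.lsum K fun s =>
    LinearMap.toSpanSingleton K _ (Finsupp.lmapDomain K K (TreeMonomial.graft s))

theorem freeAct_comp (f : TreeMonomial X (Option A) →₀ K) (g : TreeMonomial X B →₀ K)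
    (a : A ⊕ B → M) :
    freeAct op (A ⊕ B) (freeComp K X A B f g) a =
      freeAct op (Option A) f
        (fun o => o.elim (freeAct op B g (fun m => a (Sum.inr m))) (fun l => a (Sum.inl l))) := by
  classical
  -- Writing the plugged value as an update at `none` makes multilinearity applicable; the default
  -- `0` is overwritten.
  have upd (x : M) : (fun o : Option A => o.elim x (fun l => a (Sum.inl l))) =
      Function.update (fun o : Option A => o.elim 0 (fun l => a (Sum.inl l))) none x := by
    funext o
    rcases o with _ | o <;> simp
  induction f using Finsupp.induction_linear with
  | zero => simp
  | add f g hf hg => simp only [map_add, LinearMap.add_apply, add_apply, hf, hg]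
  | single s c =>
    rw [upd]
    induction g using Finsupp.induction_linear with
    | zero => simp
    | add f g hf hg =>
      simp only [map_add, add_apply, hf, hg, MultilinearMap.map_update_add]
    | single t d =>
      rw [freeAct_single op t, MultilinearMap.map_update_smul, ← upd, freeAct_single, freeComp,
        Finsupp.lsum_single, LinearMap.toSpanSingleton_apply, LinearMap.smul_apply,
        Finsupp.lmapDomain_apply, Finsupp.mapDomain_single, map_smul, smul_apply,
        freeAct_single, smul_comm]
      refine congrArg (d • c • ·) ?_
      refine (BTree.eval_bind op _ _ _).trans (congrArg _ (funext fun o => ?_))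
      rcases o with _ | o
      · exact BTree.eval_map op _ _ _
      · rfl

/-- The operadic ideal generated by `R` lies in every ideal containing `R`. Applied to these
kernels, this lets the action descend to the quotient once the relations hold. -/
theorem isIdeal_ker_freeAct :
    (freeOperad K X).IsIdeal fun L => LinearMap.ker (freeAct op L) where
  map_mem e f hf := by
    have hf : freeAct op _ f = 0 := hf
    refine MultilinearMap.ext fun a => (freeAct_map op e f a).trans ?_
    rw [hf]
    rfl
  comp_mem_left f g hf := by
    have hf : freeAct op _ f = 0 := hf
    refine MultilinearMap.ext fun a => (freeAct_comp op f g a).trans ?_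
    rw [hf]
    rfl
  comp_mem_right f g hg := by
    have hg : freeAct op _ g = 0 := hg
    refine MultilinearMap.ext fun a => (freeAct_comp op f g a).trans ?_
    rw [hg]
    exact MultilinearMap.map_coord_zero _ none rfl

variable {R : Submodule K (TreeMonomial X (Fin 3) →₀ K)}

theorem freeAct_eq_zero_of_quadraticMk_eq (hR : ∀ f ∈ R, freeAct op (Fin 3) f = 0)
    {f : TreeMonomial X L →₀ K} (hf : quadraticMk R L f = 0) : freeAct op L f = 0 :=
  (SymOperad.mem_idealSpan (freeOperad K X) _).1 ((Submodule.Quotient.mk_eq_zero _).1 hf) _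
    (isIdeal_ker_freeAct op) hR

/-- The multilinear map given by an operation of a quadratic operad, for bilinear operations that
satisfy its relations. -/
noncomputable def quadraticAct (hR : ∀ f ∈ R, freeAct op (Fin 3) f = 0) (L : Type) :
    (quadraticOperad K X R).obj L →ₗ[K] MultilinearMap K (fun _ : L => M) M :=
  ((freeOperad K X).idealSpan (R : Set (TreeMonomial X (Fin 3) →₀ K)) L).liftQ (freeAct op L)
    fun _ hf => freeAct_eq_zero_of_quadraticMk_eq op hR ((Submodule.Quotient.mk_eq_zero _).2 hf)

/-- Bilinear operations that satisfy the relations `R` define an algebra over the quadratic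
operad. -/
noncomputable def algebraOfOperations (hR : ∀ f ∈ R, freeAct op (Fin 3) f = 0) :
    (quadraticOperad K X R).Algebra M where
  act {L} _ := quadraticAct op hR L
  act_map {L _} _ _ e x a := by
    obtain ⟨f, rfl⟩ := quadraticMk_surjective R L x
    exact freeAct_map op e f a
  act_unit a := (freeAct_single op TreeMonomial.unit 1 a).trans (one_smul _ _)
  act_comp {A B} _ _ x y a := by
    obtain ⟨f, rfl⟩ := quadraticMk_surjective R (Option A) x
    obtain ⟨g, rfl⟩ := quadraticMk_surjective R B y
    exact freeAct_comp op f g a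

theorem algebraOfOperations_act_treeClass [Finite L] (hR : ∀ f ∈ R, freeAct op (Fin 3) f = 0)
    (t : TreeMonomial X L) (a : L → M) :
    (algebraOfOperations op hR).act (treeClass K R t) a = t.1.eval op a :=
  (freeAct_single op t 1 a).trans (one_smul _ _)

end AlgebraOfOperations

/-! ### Algebras over a quadratic operad through their generating operations -/

namespace SymOperad.Algebra

open TreeMonomial

variable {K : Type u} [Field K] {X L : Type} {R : Submodule K (TreeMonomial X (Fin 3) →₀ K)}
  {M : Type w} [AddCommGroup M] [Module K M] (β : (quadraticOperad K X R).Algebra M)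

theorem cons_eq_update_zero (a b : M) : ![a, b] = Function.update ![0, b] 0 a := by
  funext i
  fin_cases i <;> rfl

theorem cons_eq_update_one (a b : M) : ![a, b] = Function.update ![a, 0] 1 b := by
  funext i
  fin_cases i <;> rfl

/-- The bilinear operation of an algebra given by a generator. -/
noncomputable def op (x : X) : M →ₗ[K] M →ₗ[K] M :=
  LinearMap.mk₂ K (fun a b => β.act (treeClass K R (corolla x)) ![a, b])
    (fun a b c => by
      rw [cons_eq_update_zero, MultilinearMap.map_update_add, ← cons_eq_update_zero, ← cons_eq_update_zero])
    (fun r a b => by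
      rw [cons_eq_update_zero, MultilinearMap.map_update_smul, ← cons_eq_update_zero])
    (fun a b c => by
      rw [cons_eq_update_one, MultilinearMap.map_update_add, ← cons_eq_update_one, ← cons_eq_update_one])
    (fun r a b => by
      rw [cons_eq_update_one, MultilinearMap.map_update_smul, ← cons_eq_update_one])

theorem op_apply (x : X) (a b : M) :
    β.op x a b = β.act (treeClass K R (corolla x)) ![a, b] := rfl

theorem act_vertex (x : X) (a : Option Unit → M) :
    β.act (treeClass K R (vertex x)) a = β.op x (a none) (a (some ())) := by
  rw [← map_corolla, ← quadraticOperad_map_treeClass, β.act_map, op_apply]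
  congr 1
  funext i
  fin_cases i <;> rfl

theorem act_node {A B : Type} [Finite A] [Finite B] (x : X) (s : TreeMonomial X A)
    (t : TreeMonomial X B) (a : A ⊕ B → M) :
    β.act (treeClass K R (s.node x t)) a =
      β.op x (β.act (treeClass K R s) (a ∘ Sum.inl)) (β.act (treeClass K R t) (a ∘ Sum.inr)) := by
  rw [treeClass_node, β.act_comp, β.act_map, β.act_comp, act_vertex]
  rfl

/-- An operation given by a tree monomial acts by evaluation of the tree. -/
theorem act_treeClass [Finite L] (t : TreeMonomial X L) (a : L → M) :
    β.act (treeClass K R t) a = t.1.eval β.op a := by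
  -- The subtrees of a tree monomial do not use all of its labels, so the induction runs over
  -- arbitrary trees, each presented by a label set of its own.
  have key (t : BTree X L) : ∃ (A : Type) (_ : Finite A) (f : A → L) (t' : TreeMonomial X A),
      t'.1.map f = t ∧ ∀ a : A → M, β.act (treeClass K R t') a = t'.1.eval β.op a := by
    induction t with
    | leaf l =>
      exact ⟨Unit, inferInstance, fun _ => l, .unit, rfl, fun a => β.act_unit a⟩
    | node x s t hs ht =>
      obtain ⟨A, _, f, s', rfl, hs⟩ := hs
      obtain ⟨B, _, g, t', rfl, ht⟩ := ht
      refine ⟨A ⊕ B, inferInstance, Sum.elim f g, s'.node x t', ?_, fun a => ?_⟩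
      · exact congrArg₂ (BTree.node x) (BTree.map_map _ _ _) (BTree.map_map _ _ _)
      · rw [act_node, hs, ht, ← BTree.eval_map, ← BTree.eval_map]
        rfl
  obtain ⟨A, _, f, t', h, ht⟩ := key t.1
  obtain ⟨e, rfl, hf⟩ := exists_equiv_of_map_eq (h.trans t.1.map_id.symm)
  rw [← quadraticOperad_map_treeClass, β.act_map, ht]
  exact (BTree.eval_map β.op t'.1 e a).symm

end SymOperad.Algebra

namespace NEGen

instance : Fintype NEGen := ⟨⟨{.m, .ne}, by simp⟩, by rintro (_ | _) <;> simp⟩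

theorem sum_eq {M : Type*} [AddCommMonoid M] (g : NEGen → M) : ∑ x, g x = g .m + g .ne := by
  simp [Finset.sum, Finset.univ, Fintype.elems]

end NEGen

/-! ### Tree monomials of arity three -/

section QuadraticMonomials

variable {X : Type}

theorem leftMonomial_map_inj {a b a' b' : X} {σ τ : Equiv.Perm (Fin 3)} :
    (leftMonomial a b).map σ = (leftMonomial a' b').map τ ↔ σ = τ ∧ a = a' ∧ b = b' := by
  constructor
  · intro h
    have h := congrArg Subtype.val h
    simp only [leftMonomial, TreeMonomial.map, BTree.map, BTree.bind, BTree.node.injEq,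
      BTree.leaf.injEq] at h
    obtain ⟨rfl, ⟨rfl, h₀, h₁⟩, h₂⟩ := h
    exact ⟨Equiv.ext fun i => by fin_cases i <;> assumption, rfl, rfl⟩
  · rintro ⟨rfl, rfl, rfl⟩
    rfl

theorem rightMonomial_map_inj {a b a' b' : X} {σ τ : Equiv.Perm (Fin 3)} :
    (rightMonomial a b).map σ = (rightMonomial a' b').map τ ↔ σ = τ ∧ a = a' ∧ b = b' := by
  constructor
  · intro h
    have h := congrArg Subtype.val h
    simp only [rightMonomial, TreeMonomial.map, BTree.map, BTree.bind, BTree.node.injEq,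
      BTree.leaf.injEq] at h
    obtain ⟨rfl, h₀, rfl, h₁, h₂⟩ := h
    exact ⟨Equiv.ext fun i => by fin_cases i <;> assumption, rfl, rfl⟩
  · rintro ⟨rfl, rfl, rfl⟩
    rfl

theorem leftMonomial_map_ne (a b a' b' : X) (σ τ : Equiv.Perm (Fin 3)) :
    (leftMonomial a b).map σ ≠ (rightMonomial a' b').map τ := by
  intro h
  have h := congrArg Subtype.val h
  simp [leftMonomial, rightMonomial, TreeMonomial.map, BTree.map, BTree.bind] at h

theorem rightMonomial_map_ne (a b a' b' : X) (σ τ : Equiv.Perm (Fin 3)) :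
    (rightMonomial a b).map σ ≠ (leftMonomial a' b').map τ :=
  (leftMonomial_map_ne _ _ _ _ _ _).symm

theorem exists_map_leftMonomial_or_rightMonomial (t : TreeMonomial X (Fin 3)) :
    ∃ (a b : X) (σ : Equiv.Perm (Fin 3)),
      t = (leftMonomial a b).map σ ∨ t = (rightMonomial a b).map σ := by
  have hlen : t.1.leaves.length = 3 := by
    have := (t.2.1.getEquivOfForallMemList _ t.2.2)
    simpa using Fintype.card_congr this
  have pos (s : BTree X (Fin 3)) : 0 < s.leaves.length :=
    List.length_pos_iff.2 s.leaves_ne_nil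
  have hl (a b : X) (f : Fin 3 → Fin 3) (h : (leftMonomial a b).1.map f = t.1) :
      ∃ σ, t = (leftMonomial a b).map σ := by
    obtain ⟨e, he, -⟩ := TreeMonomial.exists_equiv_of_map_eq (h.trans t.1.map_id.symm)
    exact ⟨e, he.symm⟩
  have hr (a b : X) (f : Fin 3 → Fin 3) (h : (rightMonomial a b).1.map f = t.1) :
      ∃ σ, t = (rightMonomial a b).map σ := by
    obtain ⟨e, he, -⟩ := TreeMonomial.exists_equiv_of_map_eq (h.trans t.1.map_id.symm)
    exact ⟨e, he.symm⟩
  -- Only two of these shapes have exactly three leaves; the count excludes the others.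
  rcases ht : t.1 with i | ⟨x, i | ⟨y, i | ⟨z, r, s⟩, j | ⟨z', r', s'⟩⟩,
    k | ⟨y', i' | ⟨z'', r'', s''⟩, j' | ⟨z₃, r₃, s₃⟩⟩⟩
  case node.leaf.node.leaf.leaf =>
    obtain ⟨σ, h⟩ := hr x y' ![i, i', j'] (by rw [ht]; rfl)
    exact ⟨x, y', σ, .inr h⟩
  case node.node.leaf.leaf.leaf =>
    obtain ⟨σ, h⟩ := hl x y ![i, j, k] (by rw [ht]; rfl)
    exact ⟨x, y, σ, .inl h⟩
  all_goals
    exfalso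
    rw [ht] at hlen
    simp only [BTree.leaves, List.length_append, List.length_cons, List.length_nil] at hlen
    have := pos
    grind

variable (X) in
/-- The tree monomials with inputs `Fin 3`: those of the form `(a ∘₁ b)σ` and those of the form
`(a ∘₂ b)σ`. -/
noncomputable def quadraticMonomialEquiv :
    (Equiv.Perm (Fin 3) × X × X) ⊕ (Equiv.Perm (Fin 3) × X × X) ≃ TreeMonomial X (Fin 3) :=
  Equiv.ofBijective (Sum.elim (fun p => (leftMonomial p.2.1 p.2.2).map p.1)
    (fun p => (rightMonomial p.2.1 p.2.2).map p.1)) <| by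
    constructor
    · rintro (⟨σ, a, b⟩ | ⟨σ, a, b⟩) (⟨τ, a', b'⟩ | ⟨τ, a', b'⟩) h
      · obtain ⟨rfl, rfl, rfl⟩ := leftMonomial_map_inj.1 h
        rfl
      · exact absurd h (leftMonomial_map_ne _ _ _ _ _ _)
      · exact absurd h (rightMonomial_map_ne _ _ _ _ _ _)
      · obtain ⟨rfl, rfl, rfl⟩ := rightMonomial_map_inj.1 h
        rfl
    · intro t
      obtain ⟨a, b, σ, rfl | rfl⟩ := exists_map_leftMonomial_or_rightMonomial t
      · exact ⟨.inl (σ, a, b), rfl⟩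
      · exact ⟨.inr (σ, a, b), rfl⟩

theorem quadraticMonomialEquiv_inl (σ : Equiv.Perm (Fin 3)) (a b : X) :
    quadraticMonomialEquiv X (.inl (σ, a, b)) = (leftMonomial a b).map σ := rfl

theorem quadraticMonomialEquiv_inr (σ : Equiv.Perm (Fin 3)) (a b : X) :
    quadraticMonomialEquiv X (.inr (σ, a, b)) = (rightMonomial a b).map σ := rfl

end QuadraticMonomials

/-! ### The relations of the Koszul dual -/

section DualRelations

variable (K : Type u) [Field K]

theorem quadraticPairing_single_right {X : Type} (f : TreeMonomial X (Fin 3) →₀ K)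
    (t : TreeMonomial X (Fin 3)) :
    quadraticPairing K X f (Finsupp.single t 1) = (pairingSign t.1 : K) * f t := by
  classical
  induction f using Finsupp.induction_linear with
  | zero => simp
  | add f g hf hg => rw [map_add, LinearMap.add_apply, hf, hg, Finsupp.add_apply, mul_add]
  | single s c =>
    rw [quadraticPairing, Finsupp.lsum_single, LinearMap.toSpanSingleton_apply,
      LinearMap.smul_apply, LinearMap.smul_apply, Finsupp.lapply_apply, Finsupp.single_apply,
      Finsupp.single_apply]
    by_cases h : s = t
    · subst h; simp [mul_comm]
    · simp [h, Ne.symm h]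

theorem mapDomain_relator {X : Type} (a b c d : X) (σ : Equiv.Perm (Fin 3)) :
    Finsupp.mapDomain (TreeMonomial.map σ) (relator K a b c d) =
      Finsupp.single ((leftMonomial a b).map σ) 1 -
        Finsupp.single ((rightMonomial c d).map σ) 1 := by
  rw [relator, sub_eq_add_neg, ← Finsupp.single_neg, Finsupp.mapDomain_add,
    Finsupp.mapDomain_single, Finsupp.mapDomain_single, Finsupp.single_neg, ← sub_eq_add_neg]

/-- The two monomials have the same word of labels, hence opposite signs: the minus of the relator
becomes a plus, and the common factor `±1` cancels. -/
theorem quadraticPairing_relator_eq_zero_iff {X : Type} (f : TreeMonomial X (Fin 3) →₀ K)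
    (a b c d : X) (σ : Equiv.Perm (Fin 3)) :
    quadraticPairing K X f (Finsupp.mapDomain (TreeMonomial.map σ) (relator K a b c d)) = 0 ↔
      f ((leftMonomial a b).map σ) + f ((rightMonomial c d).map σ) = 0 := by
  have hl : pairingSign ((leftMonomial a b).map σ).1 =
      (-1) ^ wordInversions [σ 0, σ 1, σ 2] := rfl
  have hr : pairingSign ((rightMonomial c d).map σ).1 =
      -(-1) ^ wordInversions [σ 0, σ 1, σ 2] := rfl
  rw [mapDomain_relator, map_sub, quadraticPairing_single_right, quadraticPairing_single_right,
    hl, hr]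
  push_cast
  rw [neg_mul, sub_neg_eq_add, ← mul_add, mul_eq_zero, or_iff_right]
  exact pow_ne_zero _ (neg_ne_zero.2 one_ne_zero)

theorem mem_orthogonalRelations_neRelations {f : TreeMonomial NEGen (Fin 3) →₀ K} :
    f ∈ orthogonalRelations K NEGen (neRelations K) ↔ ∀ σ : Equiv.Perm (Fin 3),
      f ((leftMonomial .ne .ne).map σ) + f ((rightMonomial .ne .ne).map σ) = 0 ∧
      f ((leftMonomial .m .ne).map σ) + f ((rightMonomial .ne .m).map σ) = 0 ∧
      f ((leftMonomial .m .m).map σ) + f ((rightMonomial .m .m).map σ) = 0 := by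
  simp only [← quadraticPairing_relator_eq_zero_iff]
  constructor
  · intro h σ
    exact ⟨h _ (Submodule.subset_span ⟨σ, .inl rfl⟩),
      h _ (Submodule.subset_span ⟨σ, .inr (.inl rfl)⟩),
      h _ (Submodule.subset_span ⟨σ, .inr (.inr rfl)⟩)⟩
  · intro h
    have : neRelations K ≤ LinearMap.ker (quadraticPairing K NEGen f) := by
      refine Submodule.span_le.2 ?_
      rintro _ ⟨σ, rfl | rfl | rfl⟩
      · exact (h σ).1
      · exact (h σ).2.1
      · exact (h σ).2.2
    exact fun r hr => this hr

theorem leftMonomial_eq_map_one {X : Type} (a b : X) :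
    leftMonomial a b = (leftMonomial a b).map (1 : Equiv.Perm (Fin 3)) := rfl

theorem rightMonomial_eq_map_one {X : Type} (a b : X) :
    rightMonomial a b = (rightMonomial a b).map (1 : Equiv.Perm (Fin 3)) := rfl

/-- No relator of `P_↗` involves this monomial, so nothing constrains its coefficient in `R^⊥`. The
same holds for the right monomial that follows. -/
theorem single_leftMonomial_mem :
    Finsupp.single (leftMonomial .ne .m) 1 ∈ orthogonalRelations K NEGen (neRelations K) := by
  classical
  rw [leftMonomial_eq_map_one, mem_orthogonalRelations_neRelations]
  simp [leftMonomial_map_inj, leftMonomial_map_ne]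

theorem single_rightMonomial_mem :
    Finsupp.single (rightMonomial .m .ne) 1 ∈ orthogonalRelations K NEGen (neRelations K) := by
  classical
  rw [rightMonomial_eq_map_one, mem_orthogonalRelations_neRelations]
  simp [rightMonomial_map_inj, rightMonomial_map_ne]

theorem relator_ne_mem : Finsupp.single (leftMonomial .ne .ne) 1 -
    Finsupp.single (rightMonomial .ne .ne) 1 ∈ orthogonalRelations K NEGen (neRelations K) := by
  classical
  rw [leftMonomial_eq_map_one, rightMonomial_eq_map_one, mem_orthogonalRelations_neRelations]
  simp [Finsupp.single_apply, leftMonomial_map_inj, leftMonomial_map_ne, rightMonomial_map_inj,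
    rightMonomial_map_ne]

theorem relator_m_ne_mem : Finsupp.single (leftMonomial .m .ne) 1 -
    Finsupp.single (rightMonomial .ne .m) 1 ∈ orthogonalRelations K NEGen (neRelations K) := by
  classical
  rw [leftMonomial_eq_map_one, rightMonomial_eq_map_one, mem_orthogonalRelations_neRelations]
  simp [Finsupp.single_apply, leftMonomial_map_inj, leftMonomial_map_ne, rightMonomial_map_inj,
    rightMonomial_map_ne]

theorem relator_m_mem : Finsupp.single (leftMonomial .m .m) 1 -
    Finsupp.single (rightMonomial .m .m) 1 ∈ orthogonalRelations K NEGen (neRelations K) := by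
  classical
  rw [leftMonomial_eq_map_one, rightMonomial_eq_map_one, mem_orthogonalRelations_neRelations]
  simp [Finsupp.single_apply, leftMonomial_map_inj, leftMonomial_map_ne, rightMonomial_map_inj,
    rightMonomial_map_ne]

variable {K}

/-- The relations of `P_↗^!`, for two bilinear operations on a vector space. -/
structure NEDualRelations {M : Type w} [AddCommGroup M] [Module K M]
    (op : NEGen → M →ₗ[K] M →ₗ[K] M) : Prop where
  ne_ne : ∀ x y z, op .ne (op .ne x y) z = op .ne x (op .ne y z)
  m_ne : ∀ x y z, op .m (op .ne x y) z = op .ne x (op .m y z)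
  m_m : ∀ x y z, op .m (op .m x y) z = op .m x (op .m y z)
  ne_m_eq_zero : ∀ x y z, op .ne (op .m x y) z = 0
  m_ne_eq_zero : ∀ x y z, op .m x (op .ne y z) = 0

/-- A spanning set of `R^⊥` is not needed: for each permutation, the eight terms consist of three
pairs with equal values and opposite coefficients, and two terms with value zero. -/
theorem NEDualRelations.freeAct_eq_zero {M : Type w} [AddCommGroup M] [Module K M]
    {op : NEGen → M →ₗ[K] M →ₗ[K] M} (h : NEDualRelations op)
    (f : TreeMonomial NEGen (Fin 3) →₀ K)
    (hf : f ∈ orthogonalRelations K NEGen (neRelations K)) : freeAct op (Fin 3) f = 0 := by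
  rw [mem_orthogonalRelations_neRelations] at hf
  let _ : Fintype (TreeMonomial NEGen (Fin 3)) := Fintype.ofEquiv _ (quadraticMonomialEquiv NEGen)
  refine MultilinearMap.ext fun a => ?_
  have hl (x y : NEGen) (σ : Equiv.Perm (Fin 3)) :
      ((leftMonomial x y).map σ).evalMultilinear op a =
        op x (op y (a (σ 0)) (a (σ 1))) (a (σ 2)) := rfl
  have hr (x y : NEGen) (σ : Equiv.Perm (Fin 3)) :
      ((rightMonomial x y).map σ).evalMultilinear op a =
        op x (a (σ 0)) (op y (a (σ 1)) (a (σ 2))) := rfl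
  rw [freeAct, Finsupp.linearCombination_apply, Finsupp.sum_fintype _ _ (by simp),
    ← Equiv.sum_comp (quadraticMonomialEquiv NEGen), Fintype.sum_sum_type, Fintype.sum_prod_type,
    Fintype.sum_prod_type, ← Finset.sum_add_distrib, sum_apply]
  refine Finset.sum_eq_zero fun σ _ => ?_
  obtain ⟨h₁, h₂, h₃⟩ := hf σ
  simp only [Fintype.sum_prod_type, NEGen.sum_eq, quadraticMonomialEquiv_inl,
    quadraticMonomialEquiv_inr, add_apply, smul_apply, hl, hr, h.ne_ne, h.m_ne, h.m_m,
    h.ne_m_eq_zero, h.m_ne_eq_zero]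
  rw [add_eq_zero_iff_eq_neg] at h₁ h₂ h₃
  rw [h₁, h₂, h₃]
  change _ = (0 : M)
  module

end DualRelations

/-! ### Reduction of trees to combs -/

section Combs

variable {L : Type}

/-- Right combs all of whose vertices are `m`. -/
inductive IsMComb : BTree NEGen L → Prop
  | leaf (l : L) : IsMComb (.leaf l)
  | node (l : L) {t : BTree NEGen L} : IsMComb t → IsMComb (.node .m (.leaf l) t)

/-- Right combs whose vertices `↗` precede the vertices `m`. -/
inductive IsNEComb : BTree NEGen L → Prop
  | of_isMComb {t : BTree NEGen L} : IsMComb t → IsNEComb t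
  | node (l : L) {t : BTree NEGen L} : IsNEComb t → IsNEComb (.node .ne (.leaf l) t)

theorem IsMComb.exists_eq_map {t : BTree NEGen L} (h : IsMComb t) :
    ∃ (n : ℕ) (f : Fin (n + 1) → L), t = (neComb n 0).1.map f := by
  induction h with
  | leaf l => exact ⟨0, fun _ => l, rfl⟩
  | node l _ ih =>
    obtain ⟨n, f, rfl⟩ := ih
    refine ⟨n + 1, Fin.cons l f, ?_⟩
    refine congrArg (BTree.node NEGen.m (.leaf l)) ?_
    exact (BTree.map_map (Fin.succ : Fin (n + 1) → _) (Fin.cons l f : Fin (n + 2) → L) _).symm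

theorem neComb_succ_val (n : ℕ) (i : Fin (n + 1)) :
    (neComb (n + 1) i.succ).1 = .node .ne (.leaf 0) ((neComb n i).1.map Fin.succ) := by
  simp [neComb, rightComb]

theorem neComb_zero_val (n : ℕ) :
    (neComb (n + 1) 0).1 = .node .m (.leaf 0) ((neComb n 0).1.map Fin.succ) := rfl

theorem IsNEComb.exists_eq_map {t : BTree NEGen L} (h : IsNEComb t) :
    ∃ (n : ℕ) (i : Fin (n + 1)) (f : Fin (n + 1) → L), t = (neComb n i).1.map f := by
  induction h with
  | of_isMComb h =>
    obtain ⟨n, f, h⟩ := h.exists_eq_map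
    exact ⟨n, 0, f, h⟩
  | node l _ ih =>
    obtain ⟨n, i, f, rfl⟩ := ih
    refine ⟨n + 1, i.succ, Fin.cons l f, ?_⟩
    rw [neComb_succ_val]
    refine congrArg (BTree.node NEGen.ne (.leaf l)) ?_
    exact (BTree.map_map (Fin.succ : Fin (n + 1) → _) (Fin.cons l f : Fin (n + 2) → L) _).symm

variable (K : Type u) [Field K]

/-- The tree is a multiple of a comb in `P_↗^!`. -/
def ReducesToNEComb (s : BTree NEGen L) : Prop :=
  ∃ (c : K) (t : BTree NEGen L), Reduces (orthogonalRelations K NEGen (neRelations K)) s c t ∧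
    (c = 0 ∨ IsNEComb t)

variable {K}

theorem IsNEComb.reducesToNEComb {s : BTree NEGen L} (h : IsNEComb s) : ReducesToNEComb K s :=
  ⟨1, s, .refl s, .inr h⟩

theorem ReducesToNEComb.of_reduces {s t : BTree NEGen L} {c : K}
    (h : Reduces (orthogonalRelations K NEGen (neRelations K)) s c t)
    (ht : ReducesToNEComb K t) : ReducesToNEComb K s := by
  obtain ⟨d, u, hu, h'⟩ := ht
  refine ⟨c * d, u, h.trans hu, h'.imp_left ?_⟩
  rintro rfl
  exact mul_zero _

/-- Since a zero scalar in either subtree kills the whole tree, only products of two combs remain to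
be reduced. -/
theorem ReducesToNEComb.node {x : NEGen} {s t : BTree NEGen L} (hs : ReducesToNEComb K s)
    (ht : ReducesToNEComb K t)
    (h : ∀ s' t' : BTree NEGen L, IsNEComb s' → IsNEComb t' → ReducesToNEComb K (.node x s' t')) :
    ReducesToNEComb K (.node x s t) := by
  obtain ⟨c, s', hs, rfl | hs'⟩ := hs
  · obtain ⟨d, t', ht, -⟩ := ht
    exact ⟨_, _, hs.node x ht, .inl (zero_mul _)⟩
  · obtain ⟨d, t', ht, rfl | ht'⟩ := ht
    · exact ⟨_, _, hs.node x ht, .inl (mul_zero _)⟩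
    · exact (h s' t' hs' ht').of_reduces (hs.node x ht)

theorem IsMComb.reduces_node {s t : BTree NEGen L} (hs : IsMComb s) (ht : IsMComb t) :
    ∃ u : BTree NEGen L, IsMComb u ∧
      Reduces (orthogonalRelations K NEGen (neRelations K)) (.node .m s t) 1 u := by
  induction hs with
  | leaf l => exact ⟨_, .node l ht, .refl _⟩
  | node l _ ih =>
    obtain ⟨u, hu, h⟩ := ih
    have := (Reduces.of_sub_mem (relator_m_mem K) _ _ _).trans
      ((Reduces.refl (.leaf l)).node .m h)
    exact ⟨_, .node l hu, by simpa using this⟩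

/-- If the right factor begins with `↗`, then `m ∘ (I, ↗) = 0` applies. Otherwise it is a comb of
vertices `m`: the vertices `↗` of the left factor move to the root by `m ∘ (↗, I) = ↗ ∘ (I, m)`, and
associativity of `m` does the rest. -/
theorem IsNEComb.reducesToNEComb_node_m {s t : BTree NEGen L} (hs : IsNEComb s)
    (ht : IsNEComb t) : ReducesToNEComb K (.node .m s t) := by
  cases ht with
  | node l _ => exact ⟨_, _, .of_rightMonomial_mem (single_rightMonomial_mem K) _ _ _, .inl rfl⟩
  | of_isMComb ht =>
    induction hs with
    | of_isMComb hs =>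
      obtain ⟨u, hu, h⟩ := hs.reduces_node (K := K) ht
      exact ⟨1, u, h, .inr (.of_isMComb hu)⟩
    | node l _ ih =>
      refine .of_reduces (.of_sub_mem (relator_m_ne_mem K) _ _ _) ?_
      obtain ⟨c, u, h, hc⟩ := ih
      exact ⟨_, _, (Reduces.refl (.leaf l)).node .ne h, hc.imp (by rintro rfl; simp) (.node l)⟩

/-- Associativity of `↗` strips the left factor down to its part made of vertices `m`: a single leaf
leaves a comb, and anything longer is killed by `↗ ∘ (m, I) = 0`. -/
theorem IsNEComb.reducesToNEComb_node_ne {s t : BTree NEGen L} (hs : IsNEComb s)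
    (ht : IsNEComb t) : ReducesToNEComb K (.node .ne s t) := by
  induction hs with
  | of_isMComb hs =>
    cases hs with
    | leaf l => exact (ht.node l).reducesToNEComb
    | node l _ => exact ⟨_, _, .of_leftMonomial_mem (single_leftMonomial_mem K) _ _ _, .inl rfl⟩
  | node l _ ih =>
    refine .of_reduces (.of_sub_mem (relator_ne_mem K) _ _ _) ?_
    obtain ⟨c, u, h, hc⟩ := ih
    exact ⟨_, _, (Reduces.refl (.leaf l)).node .ne h, hc.imp (by rintro rfl; simp) (.node l)⟩

theorem reducesToNEComb (s : BTree NEGen L) : ReducesToNEComb K s := by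
  induction s with
  | leaf l => exact (IsNEComb.of_isMComb (.leaf l)).reducesToNEComb
  | node x s t hs ht =>
    refine hs.node ht fun s' t' hs' ht' => ?_
    cases x
    · exact hs'.reducesToNEComb_node_m ht'
    · exact hs'.reducesToNEComb_node_ne ht'

theorem length_leaves {X : Type} {n : ℕ} (t : TreeMonomial X (Fin n)) :
    t.1.leaves.length = n := by
  simpa using Fintype.card_congr (t.2.1.getEquivOfForallMemList _ t.2.2)

theorem exists_smul_neComb {n : ℕ} (t : TreeMonomial NEGen (Fin (n + 1))) :
    ∃ (c : K) (i : Fin (n + 1)) (σ : Equiv.Perm (Fin (n + 1))),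
      neDualTree K t = c • neDualTree K ((neComb n i).map σ) := by
  obtain ⟨c, u, h, hc⟩ := reducesToNEComb (K := K) t.1
  obtain ⟨t', rfl, h'⟩ := h.treeClass_eq
  rcases hc with rfl | hc
  · refine ⟨0, 0, 1, ?_⟩
    rw [zero_smul]
    exact h'.trans (zero_smul _ _)
  · obtain ⟨m, i, f, hf⟩ := hc.exists_eq_map
    have hlen := congrArg (fun t => t.leaves.length) hf
    simp only [BTree.leaves_map, List.length_map, length_leaves] at hlen
    -- The number of leaves fixes the size of the comb, so its labelling is a permutation.
    obtain rfl : n = m := Nat.succ_injective hlen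
    obtain ⟨σ, rfl, -⟩ := TreeMonomial.exists_equiv_of_map_eq (hf.symm.trans t'.1.map_id.symm)
    exact ⟨c, i, σ, h'⟩

variable (K) in
theorem span_range_neDualTree (L : Type) :
    Submodule.span K (Set.range fun t : TreeMonomial NEGen L => neDualTree K t) = ⊤ :=
  span_range_treeClass (orthogonalRelations K NEGen (neRelations K)) L

variable (K) in
/-- The combs span the operad `P_↗^!`. -/
theorem span_neComb (n : ℕ) :
    Submodule.span K (Set.range fun p : Equiv.Perm (Fin (n + 1)) × Fin (n + 1) =>
      neDualTree K ((neComb n p.2).map p.1)) = ⊤ := by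
  refine top_le_iff.1 ((span_range_neDualTree K (Fin (n + 1))).ge.trans (Submodule.span_le.2 ?_))
  rintro _ ⟨t, rfl⟩
  obtain ⟨c, i, σ, h⟩ := exists_smul_neComb (K := K) t
  change neDualTree K t ∈ _
  rw [h]
  exact Submodule.smul_mem _ _ (Submodule.subset_span ⟨(σ, i), rfl⟩)

end Combs

/-! ### The two products on words -/

namespace NETensor

variable (K : Type u) [Field K] {V : Type v} [AddCommGroup V] [Module K V]

/-- The tensor `v₀ ⊗ … ⊗ v_{n-1}` in the copy `(n, k)`. -/
noncomputable def word {n : ℕ} (k : Fin n) (v : Fin n → V) : NETensor K V :=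
  DirectSum.lof K (Σ n : ℕ, Fin n) (fun p => TensorPower K p.1 V) ⟨n, k⟩ (PiTensorProduct.tprod K v)

variable {K}

/-- Compares words whose lengths are equal without being so by definition, as in `(n + m) + p` and
`n + (m + p)`. -/
theorem word_congr {n m : ℕ} {k : Fin n} {l : Fin m} {v : Fin n → V} {w : Fin m → V}
    (h : n = m) (hk : (k : ℕ) = l) (hv : ∀ i, v i = w (Fin.cast h i)) :
    word K k v = word K l w := by
  subst h
  obtain rfl := Fin.ext hk
  obtain rfl : v = w := funext hv
  rfl

theorem concat_word (P : (Σ n : ℕ, Fin n) → (Σ n : ℕ, Fin n) → Prop)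
    [∀ p q, Decidable (P p q)] (c : ∀ p q : Σ n : ℕ, Fin n, Fin (p.1 + q.1)) {n m : ℕ}
    (k : Fin n) (l : Fin m) (v : Fin n → V) (w : Fin m → V) :
    concat K V P c (word K k v) (word K l w) =
      if P ⟨n, k⟩ ⟨m, l⟩ then word K (c ⟨n, k⟩ ⟨m, l⟩) (Fin.append v w) else 0 := by
  rw [concat, word, word, DirectSum.toModule_lof, LinearMap.flip_apply, DirectSum.toModule_lof]
  split_ifs with h
  · exact congrArg (DirectSum.lof K (Σ n : ℕ, Fin n) (fun p => TensorPower K p.1 V)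
      ⟨n + m, c ⟨n, k⟩ ⟨m, l⟩⟩) (TensorPower.tprod_mul_tprod K v w)
  · rfl

theorem mul_word {n m : ℕ} (k : Fin n) (l : Fin m) (v : Fin n → V) (w : Fin m → V) :
    mul K V (word K k v) (word K l w) =
      if (l : ℕ) = 0 then word K (Fin.castAdd m k) (Fin.append v w) else 0 :=
  concat_word _ _ k l v w

theorem ne_word {n m : ℕ} (k : Fin n) (l : Fin m) (v : Fin n → V) (w : Fin m → V) :
    ne K V (word K k v) (word K l w) =
      if (k : ℕ) + 1 = n then word K (Fin.natAdd n l) (Fin.append v w) else 0 :=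
  concat_word _ _ k l v w

theorem word_append_assoc {n m p : ℕ} {u : Fin n → V} {v : Fin m → V} {w : Fin p → V}
    {k : Fin (n + m + p)} {l : Fin (n + (m + p))} (h : (k : ℕ) = l) :
    word K k (Fin.append (Fin.append u v) w) = word K l (Fin.append u (Fin.append v w)) :=
  word_congr (Nat.add_assoc n m p) h fun i => by rw [Fin.append_assoc]; rfl

variable (K V) in
/-- The two products of `T_↗(V)`. -/
noncomputable def op : NEGen → NETensor K V →ₗ[K] NETensor K V →ₗ[K] NETensor K V
  | .m => mul K V
  | .ne => ne K V

/-- Linear maps that agree on the words are equal. -/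
theorem hom_ext {M : Type w} [AddCommGroup M] [Module K M] {f g : NETensor K V →ₗ[K] M}
    (h : ∀ (n : ℕ) (k : Fin n) (v : Fin n → V), f (word K k v) = g (word K k v)) : f = g := by
  refine DirectSum.linearMap_ext K fun p => PiTensorProduct.ext (MultilinearMap.ext fun v => ?_)
  exact h p.1 p.2 v

/-- Trilinear identities may be checked on words. -/
theorem trilinear_ext {f g : NETensor K V →ₗ[K] NETensor K V →ₗ[K] NETensor K V →ₗ[K] NETensor K V}
    (h : ∀ (n m p : ℕ) (i : Fin n) (j : Fin m) (k : Fin p) (u : Fin n → V) (v : Fin m → V)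
      (w : Fin p → V), f (word K i u) (word K j v) (word K k w) =
        g (word K i u) (word K j v) (word K k w)) (x y z : NETensor K V) : f x y z = g x y z := by
  have : f = g := hom_ext fun n i u => hom_ext fun m j v => hom_ext fun p k w =>
    h n m p i j k u v w
  rw [this]

/-- `(x, y, z) ↦ b (a x y) z` -/
noncomputable def leftTriple {M : Type w} [AddCommGroup M] [Module K M]
    (b a : M →ₗ[K] M →ₗ[K] M) : M →ₗ[K] M →ₗ[K] M →ₗ[K] M :=
  a.compr₂ b

/-- `(x, y, z) ↦ b x (a y z)` -/
noncomputable def rightTriple {M : Type w} [AddCommGroup M] [Module K M]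
    (b a : M →ₗ[K] M →ₗ[K] M) : M →ₗ[K] M →ₗ[K] M →ₗ[K] M :=
  ((LinearMap.llcomp K M M M).comp b).compl₂ a

theorem leftTriple_apply {M : Type w} [AddCommGroup M] [Module K M]
    (b a : M →ₗ[K] M →ₗ[K] M) (x y z : M) : leftTriple b a x y z = b (a x y) z := rfl

theorem rightTriple_apply {M : Type w} [AddCommGroup M] [Module K M]
    (b a : M →ₗ[K] M →ₗ[K] M) (x y z : M) : rightTriple b a x y z = b x (a y z) := rfl

variable (K V) in
-- On words, both sides of each of the first three relations are nonzero under the same conditions: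
-- `u`, `v` fully marked; `u` fully marked and `w` unmarked; `v`, `w` unmarked. The marks then
-- agree. An `m`-product is never fully marked and a nonzero `↗`-product never unmarked, whence the
-- last two.
theorem neDualRelations_op : NEDualRelations (op K V) where
  ne_ne := trilinear_ext (f := leftTriple (ne K V) (ne K V)) (g := rightTriple (ne K V) (ne K V)) fun n m p i j k u v w => by
    rw [leftTriple_apply, rightTriple_apply]
    by_cases h₁ : (i : ℕ) + 1 = n <;> by_cases h₂ : (j : ℕ) + 1 = m <;>
      simp [ne_word, h₁, h₂, Nat.add_assoc]
    exact word_append_assoc (by simp [Nat.add_assoc])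
  m_ne := trilinear_ext (f := leftTriple (mul K V) (ne K V)) (g := rightTriple (ne K V) (mul K V)) fun n m p i j k u v w => by
    rw [leftTriple_apply, rightTriple_apply]
    by_cases h₁ : (i : ℕ) + 1 = n <;> by_cases h₂ : (k : ℕ) = 0 <;>
      simp [mul_word, ne_word, h₁, h₂]
    exact word_append_assoc (by simp)
  m_m := trilinear_ext (f := leftTriple (mul K V) (mul K V)) (g := rightTriple (mul K V) (mul K V)) fun n m p i j k u v w => by
    rw [leftTriple_apply, rightTriple_apply]
    by_cases h₁ : (j : ℕ) = 0 <;> by_cases h₂ : (k : ℕ) = 0 <;>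
      simp [mul_word, h₁, h₂]
    exact word_append_assoc (by simp)
  ne_m_eq_zero := trilinear_ext (f := leftTriple (ne K V) (mul K V)) (g := 0) fun n m p i j k u v w => by
    rw [leftTriple_apply]
    have := j.pos
    have := i.is_lt
    by_cases h : (j : ℕ) = 0 <;> simp [mul_word, ne_word, h]
    omega
  m_ne_eq_zero := trilinear_ext (f := rightTriple (mul K V) (ne K V)) (g := 0) fun n m p i j k u v w => by
    rw [rightTriple_apply]
    by_cases h : (j : ℕ) + 1 = m <;> simp [mul_word, ne_word, h]
    omega

/-- Combs of elements of `V` are the words. -/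
theorem eval_neComb {n : ℕ} (k : Fin (n + 1)) (v : Fin (n + 1) → V) :
    (neComb n k).1.eval (op K V) (fun i => ι K V (v i)) = word K k v := by
  have hι (x : V) : ι K V x = word K (0 : Fin 1) fun _ => x := by
    refine congrArg (DirectSum.lof K (Σ n : ℕ, Fin n) (fun p => TensorPower K p.1 V) ⟨1, 0⟩) ?_
    exact PiTensorProduct.subsingletonEquiv_symm_apply' _ _
  -- Prefixing one letter produces a word of length `1 + (n + 1)`, to be compared with one of length
  -- `n + 2`.
  have happ (n : ℕ) (v : Fin (n + 2) → V) (i : Fin (1 + (n + 1))) :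
      Fin.append (fun _ : Fin 1 => v 0) (fun i : Fin (n + 1) => v i.succ) i =
        v (Fin.cast (Nat.add_comm 1 (n + 1)) i) := by
    refine Fin.addCases (fun i => ?_) (fun i => ?_) i
    · rw [Fin.append_left]
      congr 1
      ext
      simp
    · rw [Fin.append_right]
      congr 1
      ext
      simp
  induction n with
  | zero =>
    obtain rfl : k = 0 := Fin.ext (by omega)
    refine (hι _).trans (word_congr (w := v) (l := 0) rfl rfl fun i => ?_)
    obtain rfl : i = 0 := Fin.ext (by omega)
    rfl
  | succ n ih =>
    rcases Fin.eq_zero_or_eq_succ k with rfl | ⟨k, rfl⟩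
    · rw [neComb_zero_val, BTree.eval, BTree.eval_map]
      refine (congrArg _ (ih 0 fun i => v i.succ)).trans ?_
      rw [BTree.eval, hι]
      refine (mul_word _ _ _ _).trans ?_
      rw [if_pos (by simp)]
      exact word_congr (Nat.add_comm _ _) (by simp) (happ n v)
    · rw [neComb_succ_val, BTree.eval, BTree.eval_map]
      refine (congrArg _ (ih k fun i => v i.succ)).trans ?_
      rw [BTree.eval, hι]
      refine (ne_word _ _ _ _).trans ?_
      -- A word of one letter has no sign, hence no unmarked one: `0 + 1 = 1`.
      rw [if_pos (by simp)]
      exact word_congr (Nat.add_comm _ _) (by simp [Nat.add_comm]) (happ n v)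

end NETensor

/-- The coefficient at `g` of the `i`-th element of `K[G]` is the `K`-coordinate along `g · v i`, so
independence and generation over `K[G]` reduce to those over `K`. -/
theorem Representation.exists_basis_asModule {K G ι V : Type*} [Field K] [Group G] [Fintype G]
    [Fintype ι] [AddCommGroup V] [Module K V] (ρ : Representation K G V) (v : ι → V)
    (b : Module.Basis (G × ι) K V) (hb : ∀ g i, b (g, i) = ρ g (v i)) :
    ∃ B : Module.Basis ι (MonoidAlgebra K G) ρ.asModule, ∀ i, ρ.asModuleEquiv (B i) = v i := by
  have hli : LinearIndependent (MonoidAlgebra K G) fun i => ρ.asModuleEquiv.symm (v i) := by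
    rw [Fintype.linearIndependent_iff]
    intro r hr i
    have h := congrArg ρ.asModuleEquiv hr
    simp only [map_sum, ρ.asModuleEquiv_map_smul, LinearEquiv.apply_symm_apply, map_zero] at h
    have h' : ∑ p : G × ι, (r p.2).coeff p.1 • b p = 0 := by
      rw [Fintype.sum_prod_type_right, ← h]
      refine Finset.sum_congr rfl fun i _ => ?_
      rw [Representation.asAlgebraHom_def, MonoidAlgebra.lift_apply,
        Finsupp.sum_fintype _ _ (by simp), LinearMap.sum_apply]
      exact Finset.sum_congr rfl fun g _ => by rw [hb]; rfl
    have := Fintype.linearIndependent_iff.1 b.linearIndependent _ h'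
    ext g
    exact this (g, i)
  have hsp : ⊤ ≤ Submodule.span (MonoidAlgebra K G)
      (Set.range fun i => ρ.asModuleEquiv.symm (v i)) := by
    intro x _
    obtain ⟨x, rfl⟩ := ρ.asModuleEquiv.symm.surjective x
    rw [← b.sum_repr x, map_sum]
    refine sum_mem fun p _ => ?_
    rw [ρ.asModuleEquiv_symm_map_smul, hb p.1 p.2, ρ.asModuleEquiv_symm_map_rho]
    exact Submodule.smul_mem _ _ (Submodule.smul_mem _ _ (Submodule.subset_span ⟨p.2, rfl⟩))
  exact ⟨.mk hli hsp, fun i => by rw [Module.Basis.mk_apply, LinearEquiv.apply_symm_apply]⟩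

/-! ### The algebra `T_↗(V)` and its universal property -/

namespace NETensor

open TreeMonomial

section Algebra

variable (K : Type u) [Field K] (V : Type v) [AddCommGroup V] [Module K V]

/-- The structure of `P_↗^!`-algebra of `T_↗(V)`. -/
noncomputable def algebra : (neDual K).Algebra (NETensor K V) :=
  algebraOfOperations (op K V) (neDualRelations_op K V).freeAct_eq_zero

variable {K V}

theorem algebra_act_tree {L : Type} [Finite L] (t : TreeMonomial NEGen L)
    (a : L → NETensor K V) :
    (algebra K V).act (neDualTree K t) a = t.1.eval (op K V) a :=
  algebraOfOperations_act_treeClass (op K V) (neDualRelations_op K V).freeAct_eq_zero t a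

theorem algebra_act_gen (x : NEGen) (a b : NETensor K V) :
    (algebra K V).act (neDualGen K x) ![a, b] = op K V x a b :=
  algebra_act_tree _ _

theorem algebra_act_neComb {n : ℕ} (k : Fin (n + 1)) (v : Fin (n + 1) → V) :
    (algebra K V).act (neDualTree K (neComb n k)) (fun i => ι K V (v i)) = word K k v :=
  (algebra_act_tree _ _).trans (eval_neComb k v)

end Algebra

section Lift

variable {K : Type u} [Field K] {V : Type v} [AddCommGroup V] [Module K V]
  {A : Type w} [AddCommGroup A] [Module K A] (β : (neDual K).Algebra A) (g : V →ₗ[K] A)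

/-- The operations of a `P_↗^!`-algebra. -/
noncomputable def _root_.neDualOp (x : NEGen) : A →ₗ[K] A →ₗ[K] A :=
  SymOperad.Algebra.op (R := orthogonalRelations K NEGen (neRelations K)) β x

theorem _root_.neDual_act_tree {L : Type} [Finite L] (t : TreeMonomial NEGen L) (a : L → A) :
    β.act (neDualTree K t) a = t.1.eval (neDualOp β) a :=
  SymOperad.Algebra.act_treeClass (R := orthogonalRelations K NEGen (neRelations K)) β t a

/-- The linear map from `T_↗(V)` that evaluates the combs in an algebra. -/
noncomputable def lift : NETensor K V →ₗ[K] A :=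
  DirectSum.toModule K _ _ fun p => match p with
    | ⟨0, k⟩ => k.elim0
    | ⟨n + 1, k⟩ => PiTensorProduct.lift
        ((β.act (neDualTree K (neComb n k))).compLinearMap fun _ => g)

theorem lift_word {n : ℕ} (k : Fin (n + 1)) (v : Fin (n + 1) → V) :
    lift β g (word K k v) = β.act (neDualTree K (neComb n k)) fun i => g (v i) := by
  rw [lift, word, DirectSum.toModule_lof]
  exact PiTensorProduct.lift.tprod _

theorem _root_.neDual_map_tree {L L' : Type} [Finite L] [Finite L'] (e : L ≃ L')
    (t : TreeMonomial NEGen L) :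
    (neDual K).map e (neDualTree K t) = neDualTree K (t.map e) :=
  quadraticOperad_map_treeClass e t

/-- Both sides are linear in the operation, so relabelled combs suffice; for these the identity is
the definition of `lift`. No case analysis on the vanishing of products is needed. -/
theorem lift_act {n : ℕ} (x : (neDual K).obj (Fin (n + 1))) (v : Fin (n + 1) → V) :
    lift β g ((algebra K V).act x fun i => ι K V (v i)) = β.act x fun i => g (v i) := by
  have hx : x ∈ Submodule.span K (Set.range fun p : Equiv.Perm (Fin (n + 1)) × Fin (n + 1) =>
      neDualTree K ((neComb n p.2).map p.1)) := by rw [span_neComb]; trivial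
  induction hx using Submodule.span_induction with
  | zero => simp
  | add x y _ _ hx hy => simp only [map_add, add_apply, hx, hy]
  | smul c x _ hx => simp only [map_smul, smul_apply, hx]
  | mem x hx =>
    obtain ⟨⟨σ, k⟩, rfl⟩ := hx
    dsimp only
    rw [← neDual_map_tree, (algebra K V).act_map, β.act_map,
      algebra_act_neComb k fun i => v (σ i), lift_word]

/-- The product of two words is the value, on the concatenated letters, of the tree with root `x`
and the two combs as subtrees; `lift_act` applies to that tree. -/
theorem lift_op_word (x : NEGen) {n m : ℕ} (k : Fin (n + 1)) (l : Fin (m + 1))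
    (v : Fin (n + 1) → V) (w : Fin (m + 1) → V) :
    lift β g (op K V x (word K k v) (word K l w)) =
      neDualOp β x (lift β g (word K k v)) (lift β g (word K l w)) := by
  have h := lift_act β g (n := n + 1 + m) (neDualTree K (TreeMonomial.map
    (finSumFinEquiv : _ ≃ Fin ((n + 1) + (m + 1))) ((neComb n k).node x (neComb m l))))
    (Fin.append v w : Fin ((n + 1) + (m + 1)) → V)
  rw [← neDual_map_tree, (algebra K V).act_map, β.act_map, algebra_act_tree,
    neDual_act_tree] at h
  rw [lift_word, lift_word, neDual_act_tree, neDual_act_tree, ← eval_neComb, ← eval_neComb]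
  convert h using 2
  · simp only [TreeMonomial.node, BTree.eval, BTree.eval_map, Function.comp_def,
      finSumFinEquiv_apply_left, finSumFinEquiv_apply_right, Fin.append_left, Fin.append_right]
  · simp only [TreeMonomial.node, BTree.eval, BTree.eval_map, Function.comp_def,
      finSumFinEquiv_apply_left, finSumFinEquiv_apply_right, Fin.append_left, Fin.append_right]

theorem lift_op (x : NEGen) (a b : NETensor K V) :
    lift β g (op K V x a b) = neDualOp β x (lift β g a) (lift β g b) := by
  have : (op K V x).compr₂ (lift β g) = (neDualOp β x).compl₁₂ (lift β g) (lift β g) := by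
    refine hom_ext fun n k v => hom_ext fun m l w => ?_
    obtain ⟨n, rfl⟩ := Nat.exists_eq_succ_of_ne_zero k.pos.ne'
    obtain ⟨m, rfl⟩ := Nat.exists_eq_succ_of_ne_zero l.pos.ne'
    exact lift_op_word β g x k l v w
  exact LinearMap.congr_fun (LinearMap.congr_fun this a) b

theorem lift_eval {L : Type} (t : BTree NEGen L) (a : L → NETensor K V) :
    lift β g (t.eval (op K V) a) = t.eval (neDualOp β) fun l => lift β g (a l) := by
  induction t with
  | leaf l => rfl
  | node x s t hs ht => simp only [BTree.eval, lift_op, hs, ht]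

theorem lift_isHom : (algebra K V).IsHom β (lift β g) := by
  intro L _ x a
  have hx : x ∈ Submodule.span K (Set.range fun t : TreeMonomial NEGen L => neDualTree K t) := by
    rw [span_range_neDualTree]; trivial
  induction hx using Submodule.span_induction with
  | zero => simp
  | add x y _ _ hx hy => simp only [map_add, add_apply, hx, hy]
  | smul c x _ hx => simp only [map_smul, smul_apply, hx]
  | mem x hx =>
    obtain ⟨t, rfl⟩ := hx
    rw [algebra_act_tree, neDual_act_tree, lift_eval]

theorem lift_comp_ι : (lift β g).comp (ι K V) = g := by
  refine LinearMap.ext fun x => ?_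
  have h := eval_neComb (K := K) (0 : Fin 1) fun _ => x
  refine (congrArg (lift β g) h).trans ((lift_word β g _ _).trans ?_)
  exact neDual_act_tree β _ _

/-- Every word is the value of a comb on elements of `V`, so a morphism has no freedom beyond its
restriction to `V`. -/
theorem eq_lift {f : NETensor K V →ₗ[K] A} (hf : (algebra K V).IsHom β f)
    (h : f.comp (ι K V) = g) : f = lift β g := by
  refine hom_ext fun n k v => ?_
  obtain ⟨n, rfl⟩ := Nat.exists_eq_succ_of_ne_zero k.pos.ne'
  rw [lift_word, ← algebra_act_neComb, hf, ← h]
  rfl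

end Lift

section Basis

variable (K : Type u) [Field K]

/-- The coordinate of the word `e_{τ 0} ⊗ … ⊗ e_{τ n}` of the copy `(n + 1, j)`. -/
noncomputable def coordinate {n : ℕ} (τ : Equiv.Perm (Fin (n + 1))) (j : Fin (n + 1)) :
    NETensor K (Fin (n + 1) → K) →ₗ[K] K :=
  (PiTensorProduct.lift ((MultilinearMap.mkPiAlgebra K (Fin (n + 1)) K).compLinearMap
    fun l => LinearMap.proj (τ l))).comp
    (DirectSum.component K (Σ n : ℕ, Fin n)
      (fun p => TensorPower K p.1 (Fin (n + 1) → K)) ⟨n + 1, j⟩)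

/-- The coordinate in the copy `j` is the product over `l` of the entries `τ l` of `e_{σ l}`; one
factor vanishes as soon as `σ ≠ τ`. -/
theorem coordinate_word {n : ℕ} (σ τ : Equiv.Perm (Fin (n + 1))) (i j : Fin (n + 1)) :
    coordinate K τ j (word K i fun l => Pi.single (σ l) 1) =
      (Pi.single (σ, i) 1 : Equiv.Perm (Fin (n + 1)) × Fin (n + 1) → K) (τ, j) := by
  rw [coordinate, LinearMap.comp_apply, word]
  by_cases hij : i = j
  · subst hij
    rw [DirectSum.component.lof_self, PiTensorProduct.lift.tprod]
    by_cases h : σ = τ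
    · subst h
      simp
    · obtain ⟨l, hl⟩ : ∃ l, σ l ≠ τ l := by
        by_contra! hc
        exact h (Equiv.ext hc)
      rw [Pi.single_eq_of_ne (by simpa using Ne.symm h)]
      simp only [MultilinearMap.compLinearMap_apply, MultilinearMap.mkPiAlgebra_apply]
      exact Finset.prod_eq_zero (Finset.mem_univ l) (Pi.single_eq_of_ne hl.symm _)
  · rw [Pi.single_eq_of_ne (by simpa using fun _ => Ne.symm hij)]
    rw [DirectSum.component.of, dif_neg (by simpa using hij), map_zero]

end Basis

end NETensor

/-! ### The basis of combs and the dimension -/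

section Basis

variable (K : Type u) [Field K]

/-- Acting on the standard basis of `V = K^{n+1}` inside `T_↗(V)` and taking coordinates of words
sends the relabelled combs to the standard basis of the target. -/
theorem linearIndependent_neComb (n : ℕ) :
    LinearIndependent K fun p : Equiv.Perm (Fin (n + 1)) × Fin (n + 1) =>
      neDualTree K ((neComb n p.2).map p.1) := by
  let V := Fin (n + 1) → K
  let Ψ : (neDual K).obj (Fin (n + 1)) →ₗ[K] Equiv.Perm (Fin (n + 1)) × Fin (n + 1) → K :=
    LinearMap.pi fun q => (NETensor.coordinate K q.1 q.2).comp
      { toFun x := (NETensor.algebra K V).act x fun i => NETensor.ι K V (Pi.single i 1)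
        map_add' x y := by rw [map_add, add_apply]
        map_smul' c x := by rw [map_smul, smul_apply, RingHom.id_apply] }
  refine LinearIndependent.of_comp Ψ ?_
  convert Pi.linearIndependent_single_one (Equiv.Perm (Fin (n + 1)) × Fin (n + 1)) K using 1
  funext p q
  rw [← NETensor.coordinate_word, ← NETensor.algebra_act_neComb]
  refine congrArg (NETensor.coordinate K q.1 q.2) ?_
  refine (congrArg (fun x => (NETensor.algebra K V).act x _)
    (neDual_map_tree p.1 (neComb n p.2)).symm).trans ?_
  exact (NETensor.algebra K V).act_map _ _ _

/-- The relabelled combs form a basis of `P_↗^!`. -/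
noncomputable def neCombBasis (n : ℕ) :
    Module.Basis (Equiv.Perm (Fin (n + 1)) × Fin (n + 1)) K ((neDual K).obj (Fin (n + 1))) :=
  .mk (linearIndependent_neComb K n) (span_neComb K n).ge

theorem finrank_neDual (n : ℕ) :
    Module.finrank K ((neDual K).obj (Fin (n + 1))) = (n + 1) * (n + 1).factorial := by
  rw [Module.finrank_eq_card_basis (neCombBasis K n), Fintype.card_prod, Fintype.card_perm,
    Fintype.card_fin, mul_comm]

end Basis

theorem mainTheorem8 (K : Type u) [Field K] :
    (∀ n : ℕ, 1 ≤ n →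
      Module.finrank K ((neDual K).obj (Fin n)) = n * n.factorial) ∧
    (∀ n : ℕ, ∃ b : Module.Basis (Fin (n + 1)) (MonoidAlgebra K (Equiv.Perm (Fin (n + 1))))
        ((neDual K).rep (Fin (n + 1))).asModule,
      ∀ i, ((neDual K).rep (Fin (n + 1))).asModuleEquiv (b i) = neDualTree K (neComb n i)) ∧
    (∀ (V : Type v) [AddCommGroup V] [Module K V],
      ∃ α : (neDual K).Algebra (NETensor K V),
        (∀ x y : NETensor K V, α.act (neDualGen K .m) ![x, y] = NETensor.mul K V x y) ∧
        (∀ x y : NETensor K V, α.act (neDualGen K .ne) ![x, y] = NETensor.ne K V x y) ∧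
        ∀ (A : Type w) [AddCommGroup A] [Module K A] (β : (neDual K).Algebra A) (g : V →ₗ[K] A),
          ∃! f : NETensor K V →ₗ[K] A, α.IsHom β f ∧ f.comp (NETensor.ι K V) = g) := by
  refine ⟨fun n hn => ?_, fun n => ?_, fun V _ _ => ⟨NETensor.algebra K V,
    NETensor.algebra_act_gen .m, NETensor.algebra_act_gen .ne, fun A _ _ β g =>
      ⟨NETensor.lift β g, ⟨NETensor.lift_isHom β g, NETensor.lift_comp_ι β g⟩,
        fun f hf => NETensor.eq_lift β g hf.1 hf.2⟩⟩⟩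
  · obtain ⟨n, rfl⟩ := Nat.exists_eq_succ_of_ne_zero (Nat.one_le_iff_ne_zero.1 hn)
    exact finrank_neDual K n
  · refine Representation.exists_basis_asModule _ _ (neCombBasis K n) fun σ i => ?_
    exact (Module.Basis.mk_apply _ _ _).trans (neDual_map_tree σ (neComb n i)).symm
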